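/- **Languages.** Let $\Pi=\{p^1_n\mid n\in\omega\}\cup\{S^1,O^1,E^2,R^3\}$ be a set of predicate letters (the superscript is the arity), let $\epsilon^2\notin\Pi$ be a further binary letter, and let $Ind=\{v_n\mid n\in\omega\}$ be the set of individual variables. For $\Omega\subseteq\Pi$, the language $\mathcal{FO}(\Omega)$ is generated from the atoms $x\equiv y$ and $P(x_1,\dots,x_n)$ ($P^n\in\Omega$, all variables in $Ind$) by $\wedge,\vee,\to,\sim,\forall x,\exists x$. Write $\phi\leftrightarrow\psi$ for $(\phi\to\psi)\wedge(\psi\to\phi)$, $FV(\phi)$ for the set of free variables of $\phi$, and $\phi[x/y]$ for the result of replacing all free occurrences of $x$ in $\phi$ by $y$. A logic over a language $\mathcal L$ is a set of pairs $(\Gamma,\Delta)$ with $\Gamma,\Delta\subseteq\mathcal L$. **The Hilbert-style logic.** The axioms of $\mathfrak{QN4}$ over $\mathcal{FO}(\Omega)$ are all instances in $\mathcal{FO}(\Omega)$ of $\phi\to(\psi\to\phi)$; $(\phi\to(\psi\to\chi))\to((\phi\to\psi)\to(\phi\to\chi))$; $(\phi\wedge\psi)\to\phi$; $(\phi\wedge\psi)\to\psi$;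 $\phi\to(\psi\to(\phi\wedge\psi))$; $\phi\to(\phi\vee\psi)$; $\psi\to(\phi\vee\psi)$; $(\phi\to\chi)\to((\psi\to\chi)\to((\phi\vee\psi)\to\chi))$; $\forall x\phi\to\phi[x/y]$; $\phi[x/y]\to\exists x\phi$; $x\equiv x$; $y\equiv z\to(\phi[x/y]\to\phi[x/z])$; $\sim\sim\phi\leftrightarrow\phi$; $\sim(\phi\wedge\psi)\leftrightarrow(\sim\phi\vee\sim\psi)$; $\sim(\phi\vee\psi)\leftrightarrow(\sim\phi\wedge\sim\psi)$; $\sim(\phi\to\psi)\leftrightarrow(\phi\wedge\sim\psi)$; $\sim\exists x\phi\leftrightarrow\forall x\sim\phi$; $\sim\forall x\phi\leftrightarrow\exists x\sim\phi$. The rules are: from $\phi$ and $\phi\to\psi$ infer $\psi$ (MP); from $\psi\to\phi[x/y]$ infer $\psi\to\forall x\phi$; from $\phi[x/y]\to\psi$ infer $\exists x\phi\to\psi$. Wherever $\phi[x/y]$ or $\phi[x/z]$ occurs, $y$, respectively $z$, must be substitutable for $x$ in $\phi$; in the two quantifier rules moreover $y\notin FV(\psi)$ and $y\notin FV(\forall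 x\phi)=FV(\exists x\phi)$. A formula is provable if it is obtained from the axioms by the rules. The logic $\mathsf{QN4}(\Omega)$ consists of all pairs $(\Gamma,\Delta)$ of subsets of $\mathcal{FO}(\Omega)$ such that, for some $s\ge 1$ and $\theta_1,\dots,\theta_s\in\Delta$, the formula $\theta_1\vee\dots\vee\theta_s$ is obtained from formulas in $\Gamma$ and provable formulas by applications of (MP) alone. **The sheaf semantics.** A classical model over a signature is a non-empty domain $U$ with an $n$-ary relation $P\subseteq U^n$ for every letter $P^n$ of the signature; a homomorphism is a map of the domains that preserves these relations. A Nelsonian $\Omega$-sheaf is a structure $\mathcal S=(W,\le,\mathtt M^+,\mathtt M^-,\mathtt H)$, where $W\neq\emptyset$, $\le$ is a preorder on $W$, and to every $w\in W$ are assigned a classical model $\mathtt M^+_w$ over $\Omega$ and a classical model $\mathtt M^-_w$ over $\Omega\cup\{\epsilon^2\}$ with the same domain $U_w$, and to all $w\le v$ a map $\mathtt H_{wv}:U_w\to U_v$ that is a homomorphism both from $\mathtt M^+_w$ to $\mathtt M^+_v$ and from $\mathtt M^-_w$ to $\mathtt M^-_v$, such that $\mathtt H_{ww}$ is the identity and $\mathtt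 H_{wu}(a)=\mathtt H_{vu}(\mathtt H_{wv}(a))$ whenever $w\le v\le u$ and $a\in U_w$. The class $EP_n(\Omega)$ of evaluation points consists of all triples $(\mathcal S,w,f)$ with $\mathcal S$ a Nelsonian $\Omega$-sheaf, $w\in W$ and $f:Ind\to U_w$. Write $f_v:=\mathtt H_{wv}\circ f$ (first $f$, then $\mathtt H_{wv}$) and let $f[x/a]$ be $f$ with its value at $x$ changed to $a$. Positive and negative satisfaction are defined by simultaneous induction: - $\mathcal S,w\models^{\ast}P(x_1,\dots,x_n)[f]$ iff $(f(x_1),\dots,f(x_n))\in P^{\mathtt M^{\ast}_w}$, for $P^n\in\Omega$ and $\ast\in\{+,-\}$; - $\mathcal S,w\models^+(x\equiv y)[f]$ iff $f(x)=f(y)$; $\mathcal S,w\models^-(x\equiv y)[f]$ iff $(f(x),f(y))\in\epsilon^{\mathtt M^-_w}$; - $\models^+$ treats $\wedge$ and $\vee$ as "and" and "or", and $\models^-$ treats $\wedge$ and $\vee$ as "or" and "and", all at the same $w$ and $f$; - $\mathcal S,w\models^+(\psi\to\chi)[f]$ iff for all $v\ge w$: $\mathcal S,v\not\models^+\psi[f_v]$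 or $\mathcal S,v\models^+\chi[f_v]$; $\mathcal S,w\models^-(\psi\to\chi)[f]$ iff $\mathcal S,w\models^+\psi[f]$ and $\mathcal S,w\models^-\chi[f]$; - $\mathcal S,w\models^+\sim\psi[f]$ iff $\mathcal S,w\models^-\psi[f]$; $\mathcal S,w\models^-\sim\psi[f]$ iff $\mathcal S,w\models^+\psi[f]$; - $\mathcal S,w\models^+\exists x\psi[f]$ iff $\mathcal S,w\models^+\psi[f[x/a]]$ for some $a\in U_w$; $\mathcal S,w\models^-\exists x\psi[f]$ iff $\mathcal S,v\models^-\psi[f_v[x/a]]$ for all $v\ge w$ and $a\in U_v$; - $\mathcal S,w\models^+\forall x\psi[f]$ iff $\mathcal S,v\models^+\psi[f_v[x/a]]$ for all $v\ge w$ and $a\in U_v$; $\mathcal S,w\models^-\forall x\psi[f]$ iff $\mathcal S,w\models^-\psi[f[x/a]]$ for some $a\in U_w$. Let $\mathbb L(EP_n(\Omega),\models^+)$ be the logic consisting of all pairs $(\Gamma,\Delta)$ of subsets of $\mathcal{FO}(\Omega)$ such that no evaluation point in $EP_n(\Omega)$ positively satisfies every formula in $\Gamma$ and no formula in $\Delta$.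 **Proposition 6.** For every $\Omega\subseteq\Pi$, $\mathsf{QN4}(\Omega)=\mathbb L(EP_n(\Omega),\models^+)$. -/

import Mathlib

universe u v

namespace NelsonFO

/-! ### Signatures and first-order languages -/

/-- The basic predicate letters: `p n` (unary, for every `n`), `S`, `O` (unary), `E` (binary)
and `R` (ternary). -/
inductive PiLetter : Type
  | p (n : ℕ)
  | S
  | O
  | E
  | R

/-- The arity of a basic predicate letter. -/
def PiLetter.arity : PiLetter → ℕ
  | .p _ => 1
  | .S => 1
  | .O => 1
  | .E => 2
  | .R => 3

/-- All predicate letters: the basic ones, a positive and a negative copy of every basic one,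
and one further binary letter `eps`. -/
inductive Sign : Type
  | base (P : PiLetter)
  | plus (P : PiLetter)
  | minus (P : PiLetter)
  | eps

/-- The arity of a predicate letter. -/
def Sign.arity : Sign → ℕ
  | .base P => P.arity
  | .plus P => P.arity
  | .minus P => P.arity
  | .eps => 2

/-- The set `Π` of the basic predicate letters. -/
def PiSet : Set Sign := Set.range Sign.base

/-- The individual variables `v₀, v₁, …`. -/
abbrev Ind : Type := ℕ

/-- The first-order language (relational, with equality) over the signature `Ω`. -/
inductive FO (Ω : Set Sign) : Type
  | eq (x y : Ind) : FO Ω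
  | atom (P : Sign) (hP : P ∈ Ω) (x : Fin P.arity → Ind) : FO Ω
  | and (φ ψ : FO Ω) : FO Ω
  | or (φ ψ : FO Ω) : FO Ω
  | imp (φ ψ : FO Ω) : FO Ω
  | neg (φ : FO Ω) : FO Ω
  | all (x : Ind) (φ : FO Ω) : FO Ω
  | ex (x : Ind) (φ : FO Ω) : FO Ω

namespace FO

variable {Ω : Set Sign}

/-- `φ ↔ ψ` abbreviates `(φ → ψ) ∧ (ψ → φ)`. -/
def iff (φ ψ : FO Ω) : FO Ω := and (imp φ ψ) (imp ψ φ)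

/-- The disjunction `θ ∨ θ₁ ∨ … ∨ θₛ`, associated to the left. -/
def disj (θ : FO Ω) (l : List (FO Ω)) : FO Ω := l.foldl or θ

/-- The set of the free variables. -/
def FV : FO Ω → Finset Ind
  | eq x y => {x, y}
  | atom _ _ x => Finset.univ.image x
  | and φ ψ => φ.FV ∪ ψ.FV
  | or φ ψ => φ.FV ∪ ψ.FV
  | imp φ ψ => φ.FV ∪ ψ.FV
  | neg φ => φ.FV
  | all x φ => φ.FV.erase x
  | ex x φ => φ.FV.erase x

/-- `Substitutable y x φ`: no free occurrence of `x` in `φ` lies in the scope of a quantifier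
that binds `y`. -/
def Substitutable (y x : Ind) : FO Ω → Prop
  | eq _ _ => True
  | atom _ _ _ => True
  | and φ ψ => Substitutable y x φ ∧ Substitutable y x ψ
  | or φ ψ => Substitutable y x φ ∧ Substitutable y x ψ
  | imp φ ψ => Substitutable y x φ ∧ Substitutable y x ψ
  | neg φ => Substitutable y x φ
  | all z φ => x ∈ (all z φ).FV → z ≠ y ∧ Substitutable y x φ
  | ex z φ => x ∈ (ex z φ).FV → z ≠ y ∧ Substitutable y x φ

/-- `φ.subst x y` is `φ[x/y]`: every free occurrence of `x` is replaced by `y`. -/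
def subst (x y : Ind) : FO Ω → FO Ω
  | eq a b => eq (if a = x then y else a) (if b = x then y else b)
  | atom P hP a => atom P hP (fun i => if a i = x then y else a i)
  | and φ ψ => and (φ.subst x y) (ψ.subst x y)
  | or φ ψ => or (φ.subst x y) (ψ.subst x y)
  | imp φ ψ => imp (φ.subst x y) (ψ.subst x y)
  | neg φ => neg (φ.subst x y)
  | all z φ => if z = x then all z φ else all z (φ.subst x y)
  | ex z φ => if z = x then ex z φ else ex z (φ.subst x y)

end FO

/-! ### Logics, and the logic induced by a semantics -/

/-- A logic over the language `L` is a set of consecutions `(Γ, Δ)`. -/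
abbrev Logic (L : Type) : Type := Set (Set L × Set L)

/-- A semantics for the language `L`: a class of evaluation points and a satisfaction relation. -/
structure Semantics (L : Type) where
  EP : Type v
  Sat : EP → L → Prop

/-- The evaluation point satisfies every formula in `Γ` and no formula in `Δ`. -/
def Semantics.SatPair {L : Type} (σ : Semantics.{v} L) (pt : σ.EP) (Γ Δ : Set L) : Prop :=
  (∀ φ ∈ Γ, σ.Sat pt φ) ∧ (∀ ψ ∈ Δ, ¬ σ.Sat pt ψ)

/-- The logic induced by a semantics: the consecutions `(Γ, Δ)` that no evaluation point
satisfies. -/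
def inducedLogic {L : Type} (σ : Semantics.{v} L) : Logic L :=
  {c | ¬ ∃ pt : σ.EP, σ.SatPair pt c.1 c.2}

/-! ### The Hilbert-style system -/

open FO in
/-- The axioms: all instances in the language over `Ω` of the schemes of positive intuitionistic
logic with quantifiers and equality, and of the schemes for strong negation. -/
inductive IsAxiom {Ω : Set Sign} : FO Ω → Prop
  | a1 (φ ψ : FO Ω) : IsAxiom (imp φ (imp ψ φ))
  | a2 (φ ψ χ : FO Ω) :
      IsAxiom (imp (imp φ (imp ψ χ)) (imp (imp φ ψ) (imp φ χ)))
  | a3 (φ ψ : FO Ω) : IsAxiom (imp (and φ ψ) φ)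
  | a4 (φ ψ : FO Ω) : IsAxiom (imp (and φ ψ) ψ)
  | a5 (φ ψ : FO Ω) : IsAxiom (imp φ (imp ψ (and φ ψ)))
  | a6 (φ ψ : FO Ω) : IsAxiom (imp φ (or φ ψ))
  | a7 (φ ψ : FO Ω) : IsAxiom (imp ψ (or φ ψ))
  | a8 (φ ψ χ : FO Ω) :
      IsAxiom (imp (imp φ χ) (imp (imp ψ χ) (imp (or φ ψ) χ)))
  | a9 (x y : Ind) (φ : FO Ω) (hy : Substitutable y x φ) :
      IsAxiom (imp (all x φ) (φ.subst x y))
  | a10 (x y : Ind) (φ : FO Ω) (hy : Substitutable y x φ) :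
      IsAxiom (imp (φ.subst x y) (ex x φ))
  | a11 (x : Ind) : IsAxiom (eq x x)
  | a12 (x y z : Ind) (φ : FO Ω) (hy : Substitutable y x φ) (hz : Substitutable z x φ) :
      IsAxiom (imp (eq y z) (imp (φ.subst x y) (φ.subst x z)))
  | an1 (φ : FO Ω) : IsAxiom (iff (neg (neg φ)) φ)
  | an2 (φ ψ : FO Ω) : IsAxiom (iff (neg (and φ ψ)) (or (neg φ) (neg ψ)))
  | an3 (φ ψ : FO Ω) : IsAxiom (iff (neg (or φ ψ)) (and (neg φ) (neg ψ)))
  | an4 (φ ψ : FO Ω) : IsAxiom (iff (neg (imp φ ψ)) (and φ (neg ψ)))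
  | an5 (x : Ind) (φ : FO Ω) : IsAxiom (iff (neg (ex x φ)) (all x (neg φ)))
  | an6 (x : Ind) (φ : FO Ω) : IsAxiom (iff (neg (all x φ)) (ex x (neg φ)))

open FO in
/-- Provability: closure of the axioms under modus ponens and the two quantifier rules, whose
eigenvariable `y` occurs free neither in the side formula `ψ` nor in the quantified formula. -/
inductive Provable {Ω : Set Sign} : FO Ω → Prop
  | ax {φ : FO Ω} (h : IsAxiom φ) : Provable φ
  | mp {φ ψ : FO Ω} (h₁ : Provable φ) (h₂ : Provable (imp φ ψ)) : Provable ψ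
  | rAll (x y : Ind) (φ ψ : FO Ω) (hsub : Substitutable y x φ)
      (hψ : y ∉ ψ.FV) (hφ : y ∉ (all x φ).FV)
      (h : Provable (imp ψ (φ.subst x y))) : Provable (imp ψ (all x φ))
  | rEx (x y : Ind) (φ ψ : FO Ω) (hsub : Substitutable y x φ)
      (hψ : y ∉ ψ.FV) (hφ : y ∉ (ex x φ).FV)
      (h : Provable (imp (φ.subst x y) ψ)) : Provable (imp (ex x φ) ψ)

/-- Derivability from the premises `Γ`: from premises and provable formulas by modus ponens
alone. -/
inductive Derivable {Ω : Set Sign} (Γ : Set (FO Ω)) : FO Ω → Prop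
  | prem {φ : FO Ω} (h : φ ∈ Γ) : Derivable Γ φ
  | thm {φ : FO Ω} (h : Provable φ) : Derivable Γ φ
  | mp {φ ψ : FO Ω} (h₁ : Derivable Γ φ) (h₂ : Derivable Γ (FO.imp φ ψ)) : Derivable Γ ψ

/-- The logic given by the Hilbert-style system: `(Γ, Δ)` belongs to it iff some disjunction
`θ₁ ∨ … ∨ θₛ` (`s ≥ 1`) of formulas in `Δ` is derivable from `Γ`. -/
def QN4 (Ω : Set Sign) : Logic (FO Ω) :=
  {c | ∃ (θ : FO Ω) (l : List (FO Ω)),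
    θ ∈ c.2 ∧ (∀ χ ∈ l, χ ∈ c.2) ∧ Derivable c.1 (FO.disj θ l)}

/-! ### Classical models and intuitionistic Kripke sheaves -/

/-- A classical first-order model over `Ω`. -/
structure ClassicalModel (Ω : Set Sign) where
  U : Type u
  nonempty : Nonempty U
  rel : (P : Sign) → P ∈ Ω → Set (Fin P.arity → U)

/-- A homomorphism of classical models: it preserves all relations of the signature. -/
def IsHom {Ω : Set Sign} (M N : ClassicalModel.{u} Ω) (f : M.U → N.U) : Prop :=
  ∀ (P : Sign) (hP : P ∈ Ω) (a : Fin P.arity → M.U),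
    a ∈ M.rel P hP → (fun i => f (a i)) ∈ N.rel P hP

/-- An intuitionistic Kripke sheaf over `Ω`. -/
structure IntSheaf (Ω : Set Sign) where
  W : Type u
  nonempty : Nonempty W
  le : W → W → Prop
  refl : ∀ w, le w w
  trans : ∀ {w v t}, le w v → le v t → le w t
  M : W → ClassicalModel.{u} Ω
  H : ∀ {w v}, le w v → (M w).U → (M v).U
  hom : ∀ {w v} (h : le w v), IsHom (M w) (M v) (H h)
  H_id : ∀ w (a : (M w).U), H (refl w) a = a
  H_comp : ∀ {w v t} (h : le w v) (h' : le v t) (a : (M w).U), H h' (H h a) = H (trans h h') a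

/-! ### Nelsonian sheaves -/

/-- A Nelsonian sheaf over `Ω`: at every world a positive model over `Ω` and a negative model
over `Ω ∪ {eps}` on one and the same domain, and one family of transition maps, such that both
components are intuitionistic Kripke sheaves (see `NelsonSheaf.pos` and `NelsonSheaf.neg`). -/
structure NelsonSheaf (Ω : Set Sign) where
  W : Type u
  nonempty : Nonempty W
  le : W → W → Prop
  refl : ∀ w, le w w
  trans : ∀ {w v t}, le w v → le v t → le w t
  U : W → Type u
  U_nonempty : ∀ w, Nonempty (U w)
  posRel : (w : W) → (P : Sign) → P ∈ Ω → Set (Fin P.arity → U w)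
  negRel : (w : W) → (P : Sign) → P ∈ insert Sign.eps Ω → Set (Fin P.arity → U w)
  H : ∀ {w v}, le w v → U w → U v
  H_pos : ∀ {w v} (h : le w v),
    IsHom ⟨U w, U_nonempty w, posRel w⟩ ⟨U v, U_nonempty v, posRel v⟩ (H h)
  H_neg : ∀ {w v} (h : le w v),
    IsHom ⟨U w, U_nonempty w, negRel w⟩ ⟨U v, U_nonempty v, negRel v⟩ (H h)
  H_id : ∀ w (a : U w), H (refl w) a = a
  H_comp : ∀ {w v t} (h : le w v) (h' : le v t) (a : U w), H h' (H h a) = H (trans h h') a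

namespace NelsonSheaf

variable {Ω : Set Sign}

/-- The positive component. -/
def pos (S : NelsonSheaf.{u} Ω) : IntSheaf.{u} Ω where
  W := S.W
  nonempty := S.nonempty
  le := S.le
  refl := S.refl
  trans := S.trans
  M w := ⟨S.U w, S.U_nonempty w, S.posRel w⟩
  H := S.H
  hom := S.H_pos
  H_id := S.H_id
  H_comp := S.H_comp

/-- The negative component. -/
def neg (S : NelsonSheaf.{u} Ω) : IntSheaf.{u} (insert Sign.eps Ω) where
  W := S.W
  nonempty := S.nonempty
  le := S.le
  refl := S.refl
  trans := S.trans
  M w := ⟨S.U w, S.U_nonempty w, S.negRel w⟩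
  H := S.H
  hom := S.H_neg
  H_id := S.H_id
  H_comp := S.H_comp

mutual

/-- Positive satisfaction (verification). -/
def SatPos (S : NelsonSheaf.{u} Ω) : FO Ω → (w : S.W) → (Ind → S.U w) → Prop
  | .eq x y, _, f => f x = f y
  | .atom P hP x, w, f => (fun i => f (x i)) ∈ S.posRel w P hP
  | .and φ ψ, w, f => S.SatPos φ w f ∧ S.SatPos ψ w f
  | .or φ ψ, w, f => S.SatPos φ w f ∨ S.SatPos ψ w f
  | .imp φ ψ, w, f => ∀ (v : S.W) (h : S.le w v),
      ¬ S.SatPos φ v (fun i => S.H h (f i)) ∨ S.SatPos ψ v (fun i => S.H h (f i))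
  | .neg φ, w, f => S.SatNeg φ w f
  | .all x φ, w, f => ∀ (v : S.W) (h : S.le w v) (a : S.U v),
      S.SatPos φ v (Function.update (fun i => S.H h (f i)) x a)
  | .ex x φ, w, f => ∃ a : S.U w, S.SatPos φ w (Function.update f x a)
termination_by structural φ => φ

/-- Negative satisfaction (falsification). -/
def SatNeg (S : NelsonSheaf.{u} Ω) : FO Ω → (w : S.W) → (Ind → S.U w) → Prop
  | .eq x y, w, f => ![f x, f y] ∈ S.negRel w Sign.eps (Set.mem_insert _ _)
  | .atom P hP x, w, f => (fun i => f (x i)) ∈ S.negRel w P (Set.mem_insert_of_mem _ hP)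
  | .and φ ψ, w, f => S.SatNeg φ w f ∨ S.SatNeg ψ w f
  | .or φ ψ, w, f => S.SatNeg φ w f ∧ S.SatNeg ψ w f
  | .imp φ ψ, w, f => S.SatPos φ w f ∧ S.SatNeg ψ w f
  | .neg φ, w, f => S.SatPos φ w f
  | .all x φ, w, f => ∃ a : S.U w, S.SatNeg φ w (Function.update f x a)
  | .ex x φ, w, f => ∀ (v : S.W) (h : S.le w v) (a : S.U v),
      S.SatNeg φ v (Function.update (fun i => S.H h (f i)) x a)
termination_by structural φ => φ

end

end NelsonSheaf

/-- A Nelsonian evaluation point: a sheaf, a world, and an assignment into its domain. -/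
structure NelsonEP (Ω : Set Sign) where
  sheaf : NelsonSheaf.{u} Ω
  world : sheaf.W
  assign : Ind → sheaf.U world

/-- The sheaf semantics: Nelsonian evaluation points with positive satisfaction. -/
def nelsonSemantics (Ω : Set Sign) : Semantics.{u + 1} (FO Ω) where
  EP := NelsonEP.{u} Ω
  Sat pt φ := pt.sheaf.SatPos φ pt.world pt.assign

end NelsonFO

namespace NelsonFO

open FO

variable {Ω : Set Sign}

/-! ### Derivability -/

-- Soundness is an induction on proofs. Both kinds of satisfaction persist along the order
-- (`sat_mono`), and the semantic clauses for `∼` are the strong negation axioms read semantically;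
-- the quantifier and equality schemes rest on the substitution lemma `sat_subst`.
--
-- Completeness is a Henkin construction. Worlds are deductively closed prime theories with
-- witnesses, ordered by inclusion of parameters and of formulas; elements are parameters modulo
-- provable equality. Transition maps are induced by inclusion and may identify elements, which is
-- why sheaves are needed. No axiom excludes a formula together with its strong negation, so the two
-- models at a world are read off independently: the positive one from the atoms in the theory, the
-- negative one from the negated atoms, with negated equations interpreting `eps`. `exists_world`
-- produces the worlds that refute an implication, a universal formula, or all of `Δ`; `truthAt`
-- then identifies satisfaction with membership.
--
-- The obstacle is freshness. There are no constants, and `Γ` and `Δ` may already use every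
-- variable. Free variables are therefore moved to even variables of level `0` and bound ones to odd
-- variables, which leaves infinitely many fresh parameters at each higher level and rules out
-- capture. The move is harmless because provability is reflected by it (`Provable.of_ren`): only
-- finitely many variables occur in one formula, so a permutation of the variables undoes the
-- renaming up to bound variables. Changing bound variables inside `∼` calls for the congruence
-- `StrongEquiv`, which controls negations along with formulas.

theorem Provable.imp_self (φ : FO Ω) : Provable (imp φ φ) :=
  .mp (.ax (.a1 φ φ)) (.mp (.ax (.a1 φ (imp φ φ))) (.ax (.a2 φ (imp φ φ) φ)))

theorem Derivable.mono {Γ Γ' : Set (FO Ω)} (h : Γ ⊆ Γ') {φ : FO Ω} (d : Derivable Γ φ) :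
    Derivable Γ' φ := by
  induction d with
  | prem h' => exact .prem (h h')
  | thm h' => exact .thm h'
  | mp _ _ ih₁ ih₂ => exact .mp ih₁ ih₂

theorem Derivable.weaken {Γ : Set (FO Ω)} (φ : FO Ω) {ψ : FO Ω} (d : Derivable Γ ψ) :
    Derivable Γ (imp φ ψ) :=
  .mp d (.thm (.ax (.a1 ψ φ)))

theorem Derivable.deduction {Γ : Set (FO Ω)} {φ ψ : FO Ω} (d : Derivable (insert φ Γ) ψ) :
    Derivable Γ (imp φ ψ) := by
  induction d with
  | prem h =>
    rcases h with rfl | h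
    · exact .thm (.imp_self _)
    · exact (Derivable.prem h).weaken _
  | thm h => exact (Derivable.thm h).weaken _
  | mp _ _ ih₁ ih₂ => exact .mp ih₁ (.mp ih₂ (.thm (.ax (.a2 _ _ _))))

theorem Derivable.undeduction {Γ : Set (FO Ω)} {φ ψ : FO Ω} (d : Derivable Γ (imp φ ψ)) :
    Derivable (insert φ Γ) ψ :=
  .mp (.prem (Set.mem_insert _ _)) (d.mono (Set.subset_insert _ _))

theorem Derivable.cut {Γ : Set (FO Ω)} {φ ψ : FO Ω} (h₁ : Derivable Γ φ)
    (h₂ : Derivable (insert φ Γ) ψ) : Derivable Γ ψ :=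
  .mp h₁ h₂.deduction

theorem Derivable.imp_trans {Γ : Set (FO Ω)} {φ ψ χ : FO Ω} (h₁ : Derivable Γ (imp φ ψ))
    (h₂ : Derivable Γ (imp ψ χ)) : Derivable Γ (imp φ χ) :=
  .mp h₁ (.mp (h₂.weaken φ) (.thm (.ax (.a2 _ _ _))))

theorem Derivable.and_intro {Γ : Set (FO Ω)} {φ ψ : FO Ω} (h₁ : Derivable Γ φ)
    (h₂ : Derivable Γ ψ) : Derivable Γ (and φ ψ) :=
  .mp h₂ (.mp h₁ (.thm (.ax (.a5 _ _))))

theorem Derivable.and_left {Γ : Set (FO Ω)} {φ ψ : FO Ω} (h : Derivable Γ (and φ ψ)) :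
    Derivable Γ φ :=
  .mp h (.thm (.ax (.a3 _ _)))

theorem Derivable.and_right {Γ : Set (FO Ω)} {φ ψ : FO Ω} (h : Derivable Γ (and φ ψ)) :
    Derivable Γ ψ :=
  .mp h (.thm (.ax (.a4 _ _)))

theorem Derivable.or_elim {Γ : Set (FO Ω)} {φ ψ χ : FO Ω} (h₁ : Derivable Γ (imp φ χ))
    (h₂ : Derivable Γ (imp ψ χ)) : Derivable Γ (imp (or φ ψ) χ) :=
  .mp h₂ (.mp h₁ (.thm (.ax (.a8 _ _ _))))

theorem Derivable.provable {φ : FO Ω} (d : Derivable ∅ φ) : Provable φ := by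
  induction d with
  | prem h => exact h.elim
  | thm h => exact h
  | mp _ _ ih₁ ih₂ => exact .mp ih₁ ih₂

theorem Provable.iff_mp {φ ψ : FO Ω} (h : Provable (FO.iff φ ψ)) : Provable (imp φ ψ) :=
  .mp h (.ax (.a3 _ _))

theorem Provable.iff_mpr {φ ψ : FO Ω} (h : Provable (FO.iff φ ψ)) : Provable (imp ψ φ) :=
  .mp h (.ax (.a4 _ _))

theorem Provable.imp_trans {φ ψ χ : FO Ω} (h₁ : Provable (imp φ ψ)) (h₂ : Provable (imp ψ χ)) :
    Provable (imp φ χ) :=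
  (Derivable.imp_trans (Γ := ∅) (.thm h₁) (.thm h₂)).provable

/-- A derivation from `Γ` factors through a single formula, which can be found in every class
that contains `Γ` and a provable formula and is closed under conjunction. -/
theorem Derivable.exists_provable_imp {Γ : Set (FO Ω)} {χ : FO Ω} (d : Derivable Γ χ)
    (p : FO Ω → Prop) (hΓ : ∀ γ ∈ Γ, p γ) {t : FO Ω} (ht : Provable t) (hpt : p t)
    (hand : ∀ φ ψ, p φ → p ψ → p (and φ ψ)) :
    ∃ γ, p γ ∧ Derivable Γ γ ∧ Provable (imp γ χ) := by
  induction d with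
  | prem h => exact ⟨_, hΓ _ h, .prem h, .imp_self _⟩
  | thm h => exact ⟨t, hpt, .thm ht, .mp h (.ax (.a1 _ _))⟩
  | mp _ _ ih₁ ih₂ =>
    obtain ⟨γ₁, hp₁, hd₁, hi₁⟩ := ih₁
    obtain ⟨γ₂, hp₂, hd₂, hi₂⟩ := ih₂
    refine ⟨and γ₁ γ₂, hand _ _ hp₁ hp₂, hd₁.and_intro hd₂, ?_⟩
    have h₁ := Provable.imp_trans (.ax (.a3 γ₁ γ₂)) hi₁
    have h₂ := Provable.imp_trans (.ax (.a4 γ₁ γ₂)) hi₂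
    exact .mp h₁ (.mp h₂ (.ax (.a2 _ _ _)))

/-! ### Substitution -/

namespace FO

theorem subst_self (x : Ind) (φ : FO Ω) : φ.subst x x = φ := by
  induction φ with
  | eq a b => simp only [subst]; congr 1 <;> split_ifs <;> simp_all
  | atom P hP a => simp only [subst]; congr 1; funext i; split_ifs <;> simp_all
  | and φ ψ h₁ h₂ => simp [subst, h₁, h₂]
  | or φ ψ h₁ h₂ => simp [subst, h₁, h₂]
  | imp φ ψ h₁ h₂ => simp [subst, h₁, h₂]
  | neg φ h => simp [subst, h]
  | all z φ h => simp [subst, h]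
  | ex z φ h => simp [subst, h]

theorem substitutable_self (x : Ind) (φ : FO Ω) : Substitutable x x φ := by
  induction φ with
  | eq | atom => trivial
  | and _ _ h₁ h₂ | or _ _ h₁ h₂ | imp _ _ h₁ h₂ => exact ⟨h₁, h₂⟩
  | neg _ h => exact h
  | all z φ h | ex z φ h =>
    intro hx
    exact ⟨fun hz => by simp [FV, hz] at hx, h⟩

theorem subst_of_notMem {x : Ind} (y : Ind) {φ : FO Ω} (hx : x ∉ φ.FV) : φ.subst x y = φ := by
  induction φ with
  | eq a b =>
    simp only [FV, Finset.mem_insert, Finset.mem_singleton, not_or] at hx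
    simp [subst, Ne.symm hx.1, Ne.symm hx.2]
  | atom P hP a =>
    simp only [FV, Finset.mem_image, Finset.mem_univ, true_and, not_exists] at hx
    simp [subst, hx]
  | and _ _ h₁ h₂ | or _ _ h₁ h₂ | imp _ _ h₁ h₂ =>
    simp only [FV, Finset.mem_union, not_or] at hx
    simp [subst, h₁ hx.1, h₂ hx.2]
  | neg _ h => simp [subst, h hx]
  | all z φ h | ex z φ h =>
    by_cases hz : z = x
    · simp [subst, hz]
    · have : x ∉ φ.FV := fun h' => hx (by simp [FV, h', Ne.symm hz])
      simp [subst, h this]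

theorem substitutable_of_notMem {x : Ind} (y : Ind) {φ : FO Ω} (hx : x ∉ φ.FV) :
    Substitutable y x φ := by
  induction φ with
  | eq | atom => trivial
  | and _ _ h₁ h₂ | or _ _ h₁ h₂ | imp _ _ h₁ h₂ =>
    simp only [FV, Finset.mem_union, not_or] at hx
    exact ⟨h₁ hx.1, h₂ hx.2⟩
  | neg _ h => exact h hx
  | all z φ h | ex z φ h => exact fun h' => absurd h' hx

theorem FV_subst_subset (x y : Ind) (φ : FO Ω) : (φ.subst x y).FV ⊆ insert y (φ.FV.erase x) := by
  induction φ with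
  | eq a b =>
    intro z; simp only [subst, FV, Finset.mem_insert, Finset.mem_singleton, Finset.mem_erase]
    split_ifs <;> grind
  | atom P hP a =>
    intro z
    simp only [subst, FV, Finset.mem_image, Finset.mem_univ, true_and, Finset.mem_insert,
      Finset.mem_erase]
    rintro ⟨i, rfl⟩
    split_ifs with h
    · exact .inl rfl
    · exact .inr ⟨h, i, rfl⟩
  | and _ _ h₁ h₂ | or _ _ h₁ h₂ | imp _ _ h₁ h₂ => simp only [subst, FV]; grind
  | neg _ h => exact h
  | all z φ h | ex z φ h =>
    simp only [subst]
    split_ifs with hz <;> simp only [FV] <;> grind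

/-- Since `y` is not free beforehand, its free occurrences after the substitution are exactly the
replaced ones, and none of them lies under a quantifier on `x`. -/
theorem subst_subst_cancel {x y : Ind} {φ : FO Ω} (hs : Substitutable y x φ) (hy : y ∉ φ.FV) :
    (φ.subst x y).subst y x = φ ∧ Substitutable x y (φ.subst x y) := by
  induction φ with
  | eq a b =>
    simp only [FV, Finset.mem_insert, Finset.mem_singleton, not_or] at hy
    refine ⟨?_, trivial⟩
    simp only [subst]
    congr 1 <;> grind
  | atom P hP a =>
    simp only [FV, Finset.mem_image, Finset.mem_univ, true_and, not_exists] at hy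
    refine ⟨?_, trivial⟩
    simp only [subst]
    congr 1; funext i; have := hy i; grind
  | and _ _ h₁ h₂ | or _ _ h₁ h₂ | imp _ _ h₁ h₂ =>
    simp only [FV, Finset.mem_union, not_or] at hy
    have h₁ := h₁ hs.1 hy.1
    have h₂ := h₂ hs.2 hy.2
    exact ⟨by simp [subst, h₁.1, h₂.1], h₁.2, h₂.2⟩
  | neg _ h =>
    have h := h hs hy
    exact ⟨by simp [subst, h.1], h.2⟩
  | all z φ h | ex z φ h =>
    by_cases hx : x ∈ φ.FV ∧ z ≠ x
    · obtain ⟨hx, hz⟩ := hx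
      have hs := hs (by simp [FV, hx, Ne.symm hz])
      have hy' : y ∉ φ.FV := fun h' => hy (by simp [FV, h', Ne.symm hs.1])
      have h := h hs.2 hy'
      simp only [subst, if_neg hz, if_neg hs.1, h.1, true_and]
      exact fun _ => ⟨hz, h.2⟩
    · have hx' : x ∉ φ.FV.erase z := by
        simp only [Finset.mem_erase]; grind
      first
      | rw [subst_of_notMem (φ := all z φ) y hx']
      | rw [subst_of_notMem (φ := ex z φ) y hx']
      exact ⟨subst_of_notMem x hy, substitutable_of_notMem x hy⟩

end FO

-- Derived quantifier rules

theorem Provable.gen {x : Ind} {φ ψ : FO Ω} (hx : x ∉ ψ.FV) (h : Provable (imp ψ φ)) :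
    Provable (imp ψ (all x φ)) :=
  .rAll x x φ ψ (substitutable_self x φ) hx (by simp [FV]) (by rwa [subst_self])

theorem Provable.ex_elim {x : Ind} {φ ψ : FO Ω} (hx : x ∉ ψ.FV) (h : Provable (imp φ ψ)) :
    Provable (imp (ex x φ) ψ) :=
  .rEx x x φ ψ (substitutable_self x φ) hx (by simp [FV]) (by rwa [subst_self])

theorem Provable.all_imp (x : Ind) (φ : FO Ω) : Provable (imp (all x φ) φ) := by
  simpa [subst_self] using Provable.ax (.a9 x x φ (substitutable_self x φ))

theorem Provable.imp_ex (x : Ind) (φ : FO Ω) : Provable (imp φ (ex x φ)) := by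
  simpa [subst_self] using Provable.ax (.a10 x x φ (substitutable_self x φ))

/-- The closed formula `∀ x, x ≡ x` is provable. -/
theorem Provable.all_eq_self (x : Ind) : Provable (all x (eq x x) : FO Ω) := by
  -- The rule for `∀` acts on implications only, so a provable antecedent without `x` is supplied.
  refine .mp (φ := eq (x + 1) (x + 1)) (.ax (.a11 _)) (.gen (by simp [FV]) ?_)
  exact .mp (.ax (.a11 x)) (.ax (.a1 _ _))

theorem Derivable.exists_provable_imp_of_fresh {Γ : Set (FO Ω)} {χ : FO Ω} (d : Derivable Γ χ)
    {y : Ind} (hy : ∀ γ ∈ Γ, y ∉ γ.FV) :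
    ∃ γ : FO Ω, y ∉ γ.FV ∧ Derivable Γ γ ∧ Provable (imp γ χ) :=
  d.exists_provable_imp (fun γ => y ∉ γ.FV) hy (.all_eq_self 0) (by simp [FV])
    (fun _ _ h₁ h₂ => by simp [FV, h₁, h₂])

/-- The quantifier rules apply to provable formulas only. A derivation is first compressed to a
single premise in which the eigenvariable is not free. -/
theorem Derivable.all_intro {Γ : Set (FO Ω)} {x y : Ind} {φ : FO Ω}
    (hs : Substitutable y x φ) (hΓ : ∀ γ ∈ Γ, y ∉ γ.FV) (hy : y ∉ φ.FV)
    (d : Derivable Γ (φ.subst x y)) : Derivable Γ (all x φ) := by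
  obtain ⟨γ, hγ, hd, hp⟩ := d.exists_provable_imp_of_fresh hΓ
  exact .mp hd (.thm (.rAll x y φ γ hs hγ (fun h => hy (Finset.mem_of_mem_erase h)) hp))

theorem Derivable.ex_elim {Γ : Set (FO Ω)} {x y : Ind} {φ χ : FO Ω}
    (hs : Substitutable y x φ) (hΓ : ∀ γ ∈ Γ, y ∉ γ.FV) (hy : y ∉ φ.FV) (hχ : y ∉ χ.FV)
    (d : Derivable (insert (φ.subst x y) Γ) χ) : Derivable Γ (imp (ex x φ) χ) := by
  obtain ⟨γ, hγ, hd, hp⟩ := d.deduction.exists_provable_imp_of_fresh hΓ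
  -- The premises are permuted so that `imp γ χ`, which lacks `y`, becomes the side formula of the
  -- rule for `∃`.
  have h : Provable (imp (φ.subst x y) (imp γ χ)) := by
    refine Derivable.provable (Derivable.deduction (Derivable.deduction ?_))
    refine .mp (.prem (.inr (.inl rfl))) (.mp (.prem (.inl rfl)) (.thm hp))
  have h := Provable.rEx x y φ (imp γ χ) hs (by simp [FV, hγ, hχ])
    (fun h => hy (Finset.mem_of_mem_erase h)) h
  refine Derivable.deduction (.mp (hd.mono (Set.subset_insert _ _)) ?_)
  exact Derivable.undeduction (.thm h)

/-! ### Finite disjunctions -/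

theorem disj_imp_iff {Γ : Set (FO Ω)} {θ χ : FO Ω} {l : List (FO Ω)} :
    Derivable Γ (imp (disj θ l) χ) ↔
      Derivable Γ (imp θ χ) ∧ ∀ ψ ∈ l, Derivable Γ (imp ψ χ) := by
  induction l generalizing θ with
  | nil => simp [disj]
  | cons a l ih =>
    have : disj θ (a :: l) = disj (or θ a) l := rfl
    rw [this, ih]
    constructor
    · rintro ⟨h₁, h₂⟩
      refine ⟨(Derivable.thm (.ax (.a6 _ _))).imp_trans h₁, ?_⟩
      simp only [List.mem_cons, forall_eq_or_imp]
      exact ⟨(Derivable.thm (.ax (.a7 _ _))).imp_trans h₁, h₂⟩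
    · simp only [List.mem_cons, forall_eq_or_imp]
      rintro ⟨h₁, h₂, h₃⟩
      exact ⟨h₁.or_elim h₂, h₃⟩

theorem imp_disj {Γ : Set (FO Ω)} {θ ψ : FO Ω} {l : List (FO Ω)} (h : ψ = θ ∨ ψ ∈ l) :
    Derivable Γ (imp ψ (disj θ l)) := by
  have := disj_imp_iff.1 (Derivable.thm (Γ := Γ) (.imp_self (disj θ l)))
  rcases h with rfl | h
  · exact this.1
  · exact this.2 _ h

/-! ### Strong equivalence -/

/-- Provable equivalence of two formulas and of their strong negations. -/
structure StrongEquiv (φ ψ : FO Ω) : Prop where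
  mp : Provable (imp φ ψ)
  mpr : Provable (imp ψ φ)
  neg_mp : Provable (imp (neg φ) (neg ψ))
  neg_mpr : Provable (imp (neg ψ) (neg φ))

namespace StrongEquiv

theorem refl (φ : FO Ω) : StrongEquiv φ φ :=
  ⟨.imp_self _, .imp_self _, .imp_self _, .imp_self _⟩

theorem trans {φ ψ χ : FO Ω} (h₁ : StrongEquiv φ ψ) (h₂ : StrongEquiv ψ χ) : StrongEquiv φ χ :=
  ⟨h₁.mp.imp_trans h₂.mp, h₂.mpr.imp_trans h₁.mpr, h₁.neg_mp.imp_trans h₂.neg_mp,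
    h₂.neg_mpr.imp_trans h₁.neg_mpr⟩

end StrongEquiv

theorem Provable.and_mono {φ φ' ψ ψ' : FO Ω} (h₁ : Provable (imp φ φ'))
    (h₂ : Provable (imp ψ ψ')) : Provable (imp (and φ ψ) (and φ' ψ')) := by
  refine Derivable.provable (Derivable.deduction ?_)
  have h : Derivable (insert (and φ ψ) ∅) (and φ ψ) := .prem (.inl rfl)
  exact (Derivable.mp h.and_left (.thm h₁)).and_intro (.mp h.and_right (.thm h₂))

theorem Provable.or_mono {φ φ' ψ ψ' : FO Ω} (h₁ : Provable (imp φ φ'))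
    (h₂ : Provable (imp ψ ψ')) : Provable (imp (or φ ψ) (or φ' ψ')) :=
  Derivable.provable (Derivable.or_elim (.thm (h₁.imp_trans (.ax (.a6 _ _))))
    (.thm (h₂.imp_trans (.ax (.a7 _ _)))))

theorem Provable.imp_mono {φ φ' ψ ψ' : FO Ω} (h₁ : Provable (imp φ' φ))
    (h₂ : Provable (imp ψ ψ')) : Provable (imp (imp φ ψ) (imp φ' ψ')) := by
  refine Derivable.provable (Derivable.deduction ?_)
  exact (Derivable.thm h₁).imp_trans ((Derivable.prem (.inl rfl)).imp_trans (.thm h₂))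

theorem Provable.all_mono (x : Ind) {φ φ' : FO Ω} (h : Provable (imp φ φ')) :
    Provable (imp (all x φ) (all x φ')) :=
  .gen (by simp [FV]) ((Provable.all_imp x φ).imp_trans h)

theorem Provable.ex_mono (x : Ind) {φ φ' : FO Ω} (h : Provable (imp φ φ')) :
    Provable (imp (ex x φ) (ex x φ')) :=
  .ex_elim (by simp [FV]) (h.imp_trans (Provable.imp_ex x φ'))

/-- Each axiom for `∼` moves it one connective inwards; implications between negated compounds
thereby reduce to monotonicity of the dual connective. -/
theorem Provable.of_iff_iff {α α' β β' : FO Ω} (hα : IsAxiom (FO.iff α α'))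
    (hβ : IsAxiom (FO.iff β β')) (h : Provable (imp α' β')) : Provable (imp α β) :=
  ((Provable.ax hα).iff_mp.imp_trans h).imp_trans (Provable.ax hβ).iff_mpr

namespace StrongEquiv

variable {φ φ' ψ ψ' : FO Ω}

theorem neg (h : StrongEquiv φ φ') : StrongEquiv (neg φ) (neg φ') :=
  ⟨h.neg_mp, h.neg_mpr, .of_iff_iff (.an1 _) (.an1 _) h.mp, .of_iff_iff (.an1 _) (.an1 _) h.mpr⟩

theorem and (h₁ : StrongEquiv φ φ') (h₂ : StrongEquiv ψ ψ') :
    StrongEquiv (and φ ψ) (and φ' ψ') :=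
  ⟨.and_mono h₁.mp h₂.mp, .and_mono h₁.mpr h₂.mpr,
    .of_iff_iff (.an2 _ _) (.an2 _ _) (.or_mono h₁.neg_mp h₂.neg_mp),
    .of_iff_iff (.an2 _ _) (.an2 _ _) (.or_mono h₁.neg_mpr h₂.neg_mpr)⟩

theorem or (h₁ : StrongEquiv φ φ') (h₂ : StrongEquiv ψ ψ') :
    StrongEquiv (or φ ψ) (or φ' ψ') :=
  ⟨.or_mono h₁.mp h₂.mp, .or_mono h₁.mpr h₂.mpr,
    .of_iff_iff (.an3 _ _) (.an3 _ _) (.and_mono h₁.neg_mp h₂.neg_mp),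
    .of_iff_iff (.an3 _ _) (.an3 _ _) (.and_mono h₁.neg_mpr h₂.neg_mpr)⟩

theorem imp (h₁ : StrongEquiv φ φ') (h₂ : StrongEquiv ψ ψ') :
    StrongEquiv (imp φ ψ) (imp φ' ψ') :=
  ⟨.imp_mono h₁.mpr h₂.mp, .imp_mono h₁.mp h₂.mpr,
    .of_iff_iff (.an4 _ _) (.an4 _ _) (.and_mono h₁.mp h₂.neg_mp),
    .of_iff_iff (.an4 _ _) (.an4 _ _) (.and_mono h₁.mpr h₂.neg_mpr)⟩

theorem all (x : Ind) (h : StrongEquiv φ φ') : StrongEquiv (all x φ) (all x φ') :=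
  ⟨.all_mono x h.mp, .all_mono x h.mpr,
    .of_iff_iff (.an6 _ _) (.an6 _ _) (.ex_mono x h.neg_mp),
    .of_iff_iff (.an6 _ _) (.an6 _ _) (.ex_mono x h.neg_mpr)⟩

theorem ex (x : Ind) (h : StrongEquiv φ φ') : StrongEquiv (ex x φ) (ex x φ') :=
  ⟨.ex_mono x h.mp, .ex_mono x h.mpr,
    .of_iff_iff (.an5 _ _) (.an5 _ _) (.all_mono x h.neg_mp),
    .of_iff_iff (.an5 _ _) (.an5 _ _) (.all_mono x h.neg_mpr)⟩

end StrongEquiv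

-- Change of one bound variable

section Alpha

variable {x y : Ind} {φ : FO Ω}

theorem Provable.all_rename (hs : Substitutable y x φ) (hy : y ∉ φ.FV) :
    Provable (imp (all x φ) (all y (φ.subst x y))) :=
  .gen (fun h => hy (Finset.mem_of_mem_erase h)) (.ax (.a9 x y φ hs))

theorem Provable.ex_rename (hs : Substitutable y x φ) (hy : y ∉ φ.FV) :
    Provable (imp (ex y (φ.subst x y)) (ex x φ)) :=
  .ex_elim (fun h => hy (Finset.mem_of_mem_erase h)) (.ax (.a10 x y φ hs))

/-- The converse is the same renaming carried out backwards: by `subst_subst_cancel` the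
substitution is invertible, and `x` is no longer free afterwards. -/
theorem Provable.all_rename_symm (hs : Substitutable y x φ) (hy : y ∉ φ.FV) (hxy : x ≠ y) :
    Provable (imp (all y (φ.subst x y)) (all x φ)) := by
  have h := subst_subst_cancel hs hy
  have hx : x ∉ (φ.subst x y).FV := fun h' => by simpa [hxy] using FV_subst_subset x y φ h'
  simpa [h.1] using Provable.all_rename h.2 hx

theorem Provable.ex_rename_symm (hs : Substitutable y x φ) (hy : y ∉ φ.FV) (hxy : x ≠ y) :
    Provable (imp (ex x φ) (ex y (φ.subst x y))) := by
  have h := subst_subst_cancel hs hy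
  have hx : x ∉ (φ.subst x y).FV := fun h' => by simpa [hxy] using FV_subst_subset x y φ h'
  simpa [h.1] using Provable.ex_rename h.2 hx

theorem StrongEquiv.all_rename (hs : Substitutable y x φ) (hy : y ∉ φ.FV) (hxy : x ≠ y) :
    StrongEquiv (FO.all y (φ.subst x y)) (FO.all x φ) :=
  ⟨.all_rename_symm hs hy hxy, .all_rename hs hy,
    .of_iff_iff (.an6 _ _) (.an6 _ _) (Provable.ex_rename (φ := FO.neg φ) hs hy),
    .of_iff_iff (.an6 _ _) (.an6 _ _) (Provable.ex_rename_symm (φ := FO.neg φ) hs hy hxy)⟩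

theorem StrongEquiv.ex_rename (hs : Substitutable y x φ) (hy : y ∉ φ.FV) (hxy : x ≠ y) :
    StrongEquiv (FO.ex y (φ.subst x y)) (FO.ex x φ) :=
  ⟨.ex_rename hs hy, .ex_rename_symm hs hy hxy,
    .of_iff_iff (.an5 _ _) (.an5 _ _) (Provable.all_rename_symm (φ := FO.neg φ) hs hy hxy),
    .of_iff_iff (.an5 _ _) (.an5 _ _) (Provable.all_rename (φ := FO.neg φ) hs hy)⟩

end Alpha

/-! ### Soundness -/

namespace NelsonSheaf

variable (S : NelsonSheaf.{u} Ω)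

theorem H_update {w v : S.W} (h : S.le w v) (f : Ind → S.U w) (x : Ind) (a : S.U w) :
    (fun i => S.H h (Function.update f x a i)) =
      Function.update (fun i => S.H h (f i)) x (S.H h a) := by
  funext i
  by_cases hi : i = x
  · subst hi; simp
  · simp [hi]

theorem sat_congr (φ : FO Ω) : ∀ (w : S.W) (f g : Ind → S.U w), (∀ x ∈ φ.FV, f x = g x) →
    (S.SatPos φ w f ↔ S.SatPos φ w g) ∧ (S.SatNeg φ w f ↔ S.SatNeg φ w g) := by
  induction φ with
  | eq a b =>
    intro w f g h
    simp only [FV, Finset.mem_insert, Finset.mem_singleton, forall_eq_or_imp, forall_eq] at h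
    simp [SatPos, SatNeg, h.1, h.2]
  | atom P hP a =>
    intro w f g h
    simp only [FV, Finset.mem_image, Finset.mem_univ, true_and, forall_exists_index,
      forall_apply_eq_imp_iff] at h
    simp [SatPos, SatNeg, h]
  | and φ ψ h₁ h₂ | or φ ψ h₁ h₂ =>
    intro w f g h
    have h₁ := h₁ w f g (fun x hx => h x (by simp [FV, hx]))
    have h₂ := h₂ w f g (fun x hx => h x (by simp [FV, hx]))
    simp [SatPos, SatNeg, h₁, h₂]
  | imp φ ψ h₁ h₂ =>
    intro w f g h
    have k₁ := h₁ w f g (fun x hx => h x (by simp [FV, hx]))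
    have k₂ := h₂ w f g (fun x hx => h x (by simp [FV, hx]))
    simp only [SatPos, SatNeg, k₁, k₂, and_true]
    refine forall₂_congr fun v hv => ?_
    have k₁ := h₁ v (fun i => S.H hv (f i)) (fun i => S.H hv (g i))
      (fun x hx => by rw [h x (by simp [FV, hx])])
    have k₂ := h₂ v (fun i => S.H hv (f i)) (fun i => S.H hv (g i))
      (fun x hx => by rw [h x (by simp [FV, hx])])
    rw [k₁.1, k₂.1]
  | neg φ h' =>
    intro w f g h
    have h := h' w f g h
    simp [SatPos, SatNeg, h]
  | all x φ h' | ex x φ h' =>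
    intro w f g h
    have h₁ (a : S.U w) := h' w (Function.update f x a) (Function.update g x a) (by
      intro z hz
      by_cases hzx : z = x
      · simp [hzx]
      · simp [hzx, h z (by simp [FV, hz, hzx])])
    have h₂ (v : S.W) (hv : S.le w v) (a : S.U v) := h' v
      (Function.update (fun i => S.H hv (f i)) x a)
      (Function.update (fun i => S.H hv (g i)) x a) (by
      intro z hz
      by_cases hzx : z = x
      · simp [hzx]
      · simp [hzx, h z (by simp [FV, hz, hzx])])
    simp [SatPos, SatNeg, h₁, h₂]

/-- Only clauses evaluated at the current world need the induction hypotheses or the homomorphism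
property; those quantifying over later worlds persist by transitivity and `H_comp`. -/
theorem sat_mono (φ : FO Ω) : ∀ (w v : S.W) (h : S.le w v) (f : Ind → S.U w),
    (S.SatPos φ w f → S.SatPos φ v (fun i => S.H h (f i))) ∧
    (S.SatNeg φ w f → S.SatNeg φ v (fun i => S.H h (f i))) := by
  induction φ with
  | eq a b =>
    intro w v h f
    refine ⟨fun e => congrArg (S.H h) e, fun e => ?_⟩
    have := S.H_neg h _ (Set.mem_insert _ _) _ e
    have key : (![S.H h (f a), S.H h (f b)] : Fin 2 → S.U v) = fun i => S.H h (![f a, f b] i) := by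
      funext i; fin_cases i <;> rfl
    exact (congrArg (· ∈ S.negRel v Sign.eps (Set.mem_insert _ _)) key).mpr this
  | atom P hP a =>
    intro w v h f
    exact ⟨fun e => S.H_pos h P hP _ e, fun e => S.H_neg h P _ _ e⟩
  | and φ ψ h₁ h₂ =>
    intro w v h f
    exact ⟨And.imp (h₁ w v h f).1 (h₂ w v h f).1, Or.imp (h₁ w v h f).2 (h₂ w v h f).2⟩
  | or φ ψ h₁ h₂ =>
    intro w v h f
    exact ⟨Or.imp (h₁ w v h f).1 (h₂ w v h f).1, And.imp (h₁ w v h f).2 (h₂ w v h f).2⟩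
  | imp φ ψ h₁ h₂ =>
    intro w v h f
    refine ⟨fun e t ht => ?_, And.imp (h₁ w v h f).1 (h₂ w v h f).2⟩
    simpa only [S.H_comp] using e t (S.trans h ht)
  | neg φ h' =>
    intro w v h f
    exact ⟨(h' w v h f).2, (h' w v h f).1⟩
  | all x φ h' =>
    intro w v h f
    refine ⟨fun e t ht a => ?_, ?_⟩
    · simpa only [S.H_comp] using e t (S.trans h ht) a
    · rintro ⟨a, ha⟩
      exact ⟨S.H h a, by simpa only [S.H_update] using (h' w v h _).2 ha⟩
  | ex x φ h' =>
    intro w v h f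
    refine ⟨?_, fun e t ht a => ?_⟩
    · rintro ⟨a, ha⟩
      exact ⟨S.H h a, by simpa only [S.H_update] using (h' w v h _).1 ha⟩
    · simpa only [S.H_comp] using e t (S.trans h ht) a

theorem sat_subst {x y : Ind} (φ : FO Ω) (hs : Substitutable y x φ) :
    ∀ (w : S.W) (f : Ind → S.U w),
    (S.SatPos (φ.subst x y) w f ↔ S.SatPos φ w (Function.update f x (f y))) ∧
    (S.SatNeg (φ.subst x y) w f ↔ S.SatNeg φ w (Function.update f x (f y))) := by
  induction φ with
  | eq a b =>
    intro w f
    simp only [subst, SatPos, SatNeg, Function.update_apply]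
    constructor <;> split_ifs <;> rfl
  | atom P hP a =>
    intro w f
    have : (fun i => f (if a i = x then y else a i)) =
        fun i => Function.update f x (f y) (a i) := by
      funext i; by_cases h : a i = x <;> simp [h]
    simp only [subst, SatPos, SatNeg, this, and_self]
  | and φ ψ h₁ h₂ | or φ ψ h₁ h₂ =>
    intro w f
    simp [SatPos, SatNeg, subst, h₁ hs.1 w f, h₂ hs.2 w f]
  | imp φ ψ h₁ h₂ =>
    intro w f
    simp only [SatPos, SatNeg, subst, h₁ hs.1 w f, h₂ hs.2 w f, and_true, S.H_update]
    refine forall₂_congr fun v hv => ?_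
    rw [(h₁ hs.1 v _).1, (h₂ hs.2 v _).1]
  | neg φ h =>
    intro w f
    simp [SatPos, SatNeg, subst, h hs w f]
  | all z φ h | ex z φ h =>
    intro w f
    by_cases hx : x ∈ φ.FV ∧ z ≠ x
    · obtain ⟨hx, hz⟩ := hx
      have hs := hs (by simp [FV, hx, Ne.symm hz])
      have hu (v : S.W) (f : Ind → S.U v) (a : S.U v) :
          Function.update (Function.update f z a) x (Function.update f z a y) =
            Function.update (Function.update f x (f y)) z a := by
        rw [Function.update_of_ne hs.1.symm, Function.update_comm hz]
      simp [SatPos, SatNeg, subst, hz, h hs.2, hu, S.H_update]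
    -- Here `x` is not free in the quantified formula: the substitution does nothing, and changing
    -- the value at `x` is invisible.
    · have hx' : x ∉ φ.FV.erase z := by
        simp only [Finset.mem_erase]; grind
      first
      | rw [subst_of_notMem (φ := all z φ) y hx']
      | rw [subst_of_notMem (φ := ex z φ) y hx']
      refine S.sat_congr _ w _ _ fun t ht => ?_
      rw [Function.update_of_ne]
      rintro rfl
      exact hx' ht

theorem satPos_imp {φ ψ : FO Ω} {w : S.W} {f : Ind → S.U w} :
    S.SatPos (imp φ ψ) w f ↔ ∀ (v : S.W) (h : S.le w v),
      S.SatPos φ v (fun i => S.H h (f i)) → S.SatPos ψ v (fun i => S.H h (f i)) := by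
  simp only [SatPos, imp_iff_not_or]

theorem satPos_mp {φ ψ : FO Ω} {w : S.W} {f : Ind → S.U w} (h₁ : S.SatPos (imp φ ψ) w f)
    (h₂ : S.SatPos φ w f) : S.SatPos ψ w f := by
  have h := S.satPos_imp.1 h₁ w (S.refl w)
  simp only [S.H_id] at h
  exact h h₂

theorem satPos_iff {φ ψ : FO Ω} (h : ∀ (w : S.W) (f : Ind → S.U w),
    S.SatPos φ w f ↔ S.SatPos ψ w f) (w : S.W) (f : Ind → S.U w) :
    S.SatPos (FO.iff φ ψ) w f :=
  ⟨S.satPos_imp.2 fun v _ => (h v _).1, S.satPos_imp.2 fun v _ => (h v _).2⟩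

theorem satPos_of_isAxiom {φ : FO Ω} (hφ : IsAxiom φ) (w : S.W) (f : Ind → S.U w) :
    S.SatPos φ w f := by
  cases hφ with
  | a1 φ ψ =>
    refine S.satPos_imp.2 fun v _ h₁ => S.satPos_imp.2 fun t ht _ => ?_
    exact (S.sat_mono φ _ _ ht _).1 h₁
  | a2 φ ψ χ =>
    refine S.satPos_imp.2 fun v _ h₁ => S.satPos_imp.2 fun t ht h₂ =>
      S.satPos_imp.2 fun s hs h₃ => ?_
    have k₁ := (S.sat_mono _ _ _ hs _).1 ((S.sat_mono _ _ _ ht _).1 h₁)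
    have k₂ := (S.sat_mono _ _ _ hs _).1 h₂
    exact S.satPos_mp (S.satPos_mp k₁ h₃) (S.satPos_mp k₂ h₃)
  | a3 φ ψ => exact S.satPos_imp.2 fun v _ h₁ => h₁.1
  | a4 φ ψ => exact S.satPos_imp.2 fun v _ h₁ => h₁.2
  | a5 φ ψ =>
    refine S.satPos_imp.2 fun v _ h₁ => S.satPos_imp.2 fun t ht h₂ => ?_
    exact ⟨(S.sat_mono φ _ _ ht _).1 h₁, h₂⟩
  | a6 φ ψ => exact S.satPos_imp.2 fun v _ h₁ => Or.inl h₁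
  | a7 φ ψ => exact S.satPos_imp.2 fun v _ h₁ => Or.inr h₁
  | a8 φ ψ χ =>
    refine S.satPos_imp.2 fun v _ h₁ => S.satPos_imp.2 fun t ht h₂ =>
      S.satPos_imp.2 fun s hs h₃ => ?_
    have k₁ := (S.sat_mono _ _ _ hs _).1 ((S.sat_mono _ _ _ ht _).1 h₁)
    have k₂ := (S.sat_mono _ _ _ hs _).1 h₂
    exact h₃.elim (S.satPos_mp k₁) (S.satPos_mp k₂)
  | a9 x y φ hy =>
    refine S.satPos_imp.2 fun v _ h₁ => ?_
    rw [(S.sat_subst φ hy _ _).1]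
    have := h₁ v (S.refl v)
    simp only [S.H_id] at this
    exact this _
  | a10 x y φ hy =>
    refine S.satPos_imp.2 fun v _ h₁ => ?_
    rw [(S.sat_subst φ hy _ _).1] at h₁
    exact ⟨_, h₁⟩
  | a11 x => exact rfl
  | a12 x y z φ hy hz =>
    refine S.satPos_imp.2 fun v _ h₁ => S.satPos_imp.2 fun t ht h₂ => ?_
    rw [(S.sat_subst φ hy _ _).1] at h₂
    rw [(S.sat_subst φ hz _ _).1]
    have := (S.sat_mono _ _ _ ht _).1 h₁
    simp only [SatPos] at this
    rwa [← this]
  -- For the strong negation axioms both sides have the same satisfaction clause by definition.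
  | an1 φ => exact S.satPos_iff (fun _ _ => Iff.rfl) w f
  | an2 φ ψ => exact S.satPos_iff (fun _ _ => Iff.rfl) w f
  | an3 φ ψ => exact S.satPos_iff (fun _ _ => Iff.rfl) w f
  | an4 φ ψ => exact S.satPos_iff (fun _ _ => Iff.rfl) w f
  | an5 x φ => exact S.satPos_iff (fun _ _ => Iff.rfl) w f
  | an6 x φ => exact S.satPos_iff (fun _ _ => Iff.rfl) w f

theorem satPos_update_subst {x y : Ind} {φ : FO Ω} (hs : Substitutable y x φ)
    (hy : y ∉ φ.FV.erase x) (w : S.W) (f : Ind → S.U w) (a : S.U w) :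
    S.SatPos (φ.subst x y) w (Function.update f y a) ↔
      S.SatPos φ w (Function.update f x a) := by
  rw [(S.sat_subst φ hs _ _).1, Function.update_self]
  refine (S.sat_congr φ w _ _ fun z hz => ?_).1
  by_cases hzx : z = x
  · simp [hzx]
  · have : z ≠ y := by rintro rfl; exact hy (Finset.mem_erase.2 ⟨hzx, hz⟩)
    simp [hzx, this]

theorem satPos_update_of_notMem {y : Ind} {ψ : FO Ω} (hy : y ∉ ψ.FV) (w : S.W)
    (f : Ind → S.U w) (a : S.U w) :
    S.SatPos ψ w (Function.update f y a) ↔ S.SatPos ψ w f := by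
  refine (S.sat_congr ψ w _ _ fun z hz => ?_).1
  rw [Function.update_of_ne]
  rintro rfl
  exact hy hz

theorem satPos_of_provable {φ : FO Ω} (hφ : Provable φ) :
    ∀ (w : S.W) (f : Ind → S.U w), S.SatPos φ w f := by
  induction hφ with
  | ax h => exact S.satPos_of_isAxiom h
  | mp _ _ ih₁ ih₂ => exact fun w f => S.satPos_mp (ih₂ w f) (ih₁ w f)
  | rAll x y φ ψ hsub hψ hφ _ ih =>
    refine fun w f => S.satPos_imp.2 fun v hv h₁ t ht a => ?_
    have h₂ := (S.sat_mono _ _ _ ht _).1 h₁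
    -- The eigenvariable `y` is given the value `a`, which the side formula does not notice.
    rw [← S.satPos_update_of_notMem hψ _ _ a] at h₂
    exact (S.satPos_update_subst hsub hφ _ _ _).1 (S.satPos_mp (ih _ _) h₂)
  | rEx x y φ ψ hsub hψ hφ _ ih =>
    refine fun w f => S.satPos_imp.2 fun v hv h₁ => ?_
    obtain ⟨a, ha⟩ := h₁
    rw [← S.satPos_update_subst hsub hφ] at ha
    exact (S.satPos_update_of_notMem hψ _ _ a).1 (S.satPos_mp (ih _ _) ha)

theorem satPos_of_derivable {Γ : Set (FO Ω)} {φ : FO Ω} (d : Derivable Γ φ) {w : S.W}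
    {f : Ind → S.U w} (h : ∀ γ ∈ Γ, S.SatPos γ w f) : S.SatPos φ w f := by
  induction d with
  | prem h' => exact h _ h'
  | thm h' => exact S.satPos_of_provable h' w f
  | mp _ _ ih₁ ih₂ => exact S.satPos_mp ih₂ ih₁

theorem satPos_disj {θ : FO Ω} {l : List (FO Ω)} {w : S.W} {f : Ind → S.U w}
    (h : S.SatPos (disj θ l) w f) : S.SatPos θ w f ∨ ∃ χ ∈ l, S.SatPos χ w f := by
  induction l generalizing θ with
  | nil => exact .inl h
  | cons a l ih =>
    rcases ih (θ := or θ a) h with (h | h) | ⟨χ, h, h'⟩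
    · exact .inl h
    · exact .inr ⟨a, by simp, h⟩
    · exact .inr ⟨χ, by simp [h], h'⟩

end NelsonSheaf

theorem QN4_subset_inducedLogic (Ω : Set Sign) :
    QN4 Ω ⊆ inducedLogic (nelsonSemantics.{u} Ω) := by
  rintro ⟨Γ, Δ⟩ ⟨θ, l, hθ, hl, d⟩ ⟨pt, hΓ, hΔ⟩
  rcases pt.sheaf.satPos_disj (pt.sheaf.satPos_of_derivable d hΓ) with h | ⟨χ, hχ, h⟩
  · exact hΔ θ hθ h
  · exact hΔ χ (hl χ hχ) h

/-! ### Renaming of variables -/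

namespace FO

/-- The renaming of the free variables by `g` and of the bound variables by `b`. -/
def ren (b : Ind → Ind) : FO Ω → (Ind → Ind) → FO Ω
  | eq x y, g => eq (g x) (g y)
  | atom P hP x, g => atom P hP (fun i => g (x i))
  | and φ ψ, g => and (φ.ren b g) (ψ.ren b g)
  | or φ ψ, g => or (φ.ren b g) (ψ.ren b g)
  | imp φ ψ, g => imp (φ.ren b g) (ψ.ren b g)
  | neg φ, g => neg (φ.ren b g)
  | all x φ, g => all (b x) (φ.ren b (Function.update g x (b x)))
  | ex x φ, g => ex (b x) (φ.ren b (Function.update g x (b x)))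

/-- The set of all variables, free or bound. -/
def vars : FO Ω → Finset Ind
  | eq x y => {x, y}
  | atom _ _ x => Finset.univ.image x
  | and φ ψ => φ.vars ∪ ψ.vars
  | or φ ψ => φ.vars ∪ ψ.vars
  | imp φ ψ => φ.vars ∪ ψ.vars
  | neg φ => φ.vars
  | all x φ => insert x φ.vars
  | ex x φ => insert x φ.vars

theorem ren_congr {b b' : Ind → Ind} (φ : FO Ω) : ∀ {g g' : Ind → Ind},
    (∀ x ∈ φ.vars, b x = b' x ∧ g x = g' x) → φ.ren b g = φ.ren b' g' := by
  induction φ with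
  | eq x y =>
    intro g g' h
    simp [ren, (h x (by simp [vars])).2, (h y (by simp [vars])).2]
  | atom P hP x =>
    intro g g' h
    simp only [ren]
    congr 1; funext i; exact (h (x i) (by simp [vars])).2
  | and φ ψ h₁ h₂ | or φ ψ h₁ h₂ | imp φ ψ h₁ h₂ =>
    intro g g' h
    simp only [ren, h₁ (fun x hx => h x (by simp [vars, hx])),
      h₂ (fun x hx => h x (by simp [vars, hx]))]
  | neg φ h' =>
    intro g g' h
    simp only [ren, h' h]
  | all x φ h' | ex x φ h' =>
    intro g g' h
    have hx := (h x (by simp [vars])).1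
    simp only [ren]
    rw [← hx, h' (g' := Function.update g' x (b x))]
    intro z hz
    have hz := h z (by simp [vars, hz])
    refine ⟨hz.1, ?_⟩
    by_cases hzx : z = x <;> simp [hzx, hz.2]

theorem ren_ren {b b' : Ind → Ind} (σ : Ind → Ind) (hb : ∀ x, σ (b x) = b' x) (φ : FO Ω) :
    ∀ g : Ind → Ind, (φ.ren b g).ren σ σ = φ.ren b' (σ ∘ g) := by
  induction φ with
  | eq x y => intro g; simp [ren]
  | atom P hP x => intro g; simp [ren]
  | and φ ψ h₁ h₂ | or φ ψ h₁ h₂ | imp φ ψ h₁ h₂ => intro g; simp [ren, h₁, h₂]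
  | neg φ h => intro g; simp [ren, h]
  | all x φ h | ex x φ h =>
    intro g
    simp only [ren, ← hb, Function.update_eq_self, h, Function.comp_update]

theorem FV_ren_subset {b : Ind → Ind} (φ : FO Ω) :
    ∀ g : Ind → Ind, (φ.ren b g).FV ⊆ φ.FV.image g := by
  induction φ with
  | eq x y => intro g; simp [ren, FV, Finset.image_insert]
  | atom P hP x => intro g; simp [ren, FV, Finset.image_image, Function.comp_def]
  | and φ ψ h₁ h₂ | or φ ψ h₁ h₂ | imp φ ψ h₁ h₂ =>
    intro g
    simp only [ren, FV, Finset.image_union]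
    exact Finset.union_subset_union (h₁ g) (h₂ g)
  | neg φ h => intro g; exact h g
  | all x φ h | ex x φ h =>
    intro g y hy
    simp only [ren, FV, Finset.mem_erase] at hy
    obtain ⟨z, hz, rfl⟩ := Finset.mem_image.1 (h _ hy.2)
    have hzx : z ≠ x := by rintro rfl; simp at hy
    simp only [Function.update_of_ne hzx]
    exact Finset.mem_image_of_mem g (by simp [FV, hzx, hz])

/-- The condition says that a binder renamed to `u` captures nothing but its own variable. Hence the
free occurrences of `u` after renaming come exactly from the free variables that `g` sends to `u`.
-/
theorem subst_ren {b : Ind → Ind} {u : Ind} (y : Ind) (φ : FO Ω) :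
    ∀ g : Ind → Ind, (∀ z a, b z = u → g a = u → a = z) →
      (φ.ren b g).subst u y = φ.ren b (fun a => if g a = u then y else g a) := by
  induction φ with
  | eq | atom => intro g _; simp only [ren, subst]
  | and φ ψ h₁ h₂ | or φ ψ h₁ h₂ | imp φ ψ h₁ h₂ =>
    intro g hg; simp only [ren, subst, h₁ g hg, h₂ g hg]
  | neg φ h => intro g hg; simp only [ren, subst, h g hg]
  | all x φ h | ex x φ h =>
    intro g hg
    simp only [ren, subst]
    split_ifs with hx
    · congr 2
      funext a
      by_cases ha : a = x
      · simp [ha]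
      · simp only [Function.update_of_ne ha]
        rw [if_neg fun h' => ha (hg x a hx h')]
    · rw [h]
      · congr 2
        funext a
        by_cases ha : a = x <;> simp [ha, hx]
      · intro z a hz
        by_cases ha : a = x
        · subst ha
          simp [hx]
        · simpa [ha] using hg z a hz

theorem substitutable_ren {b : Ind → Ind} {u y : Ind} (hu : ∀ z, b z ≠ u) (φ : FO Ω) :
    ∀ g : Ind → Ind, (∀ z a, b z = y → g a = u → a = z) → Substitutable y u (φ.ren b g) := by
  induction φ with
  | eq | atom => intro g _; trivial
  | and φ ψ h₁ h₂ | or φ ψ h₁ h₂ | imp φ ψ h₁ h₂ => intro g hg; exact ⟨h₁ g hg, h₂ g hg⟩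
  | neg φ h => intro g hg; exact h g hg
  | all x φ h | ex x φ h =>
    intro g hg hmem
    refine ⟨fun hx => ?_, h _ fun z a hz => ?_⟩
    · obtain ⟨a, ha, hau⟩ := Finset.mem_image.1 (FV_ren_subset (all x φ) g hmem)
      exact (Finset.mem_erase.1 ha).1 (hg x a hx hau)
    · by_cases ha : a = x
      · subst ha; simp [hu]
      · simpa [ha] using hg z a hz

theorem mem_FV_ren {σ : Ind → Ind} (hσ : Function.Injective σ) (φ : FO Ω) (x : Ind) : σ x ∈ (φ.ren σ σ).FV ↔ x ∈ φ.FV := by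
  induction φ with
  | eq | atom => simp [ren, FV, hσ.eq_iff]
  | and _ _ h₁ h₂ | or _ _ h₁ h₂ | imp _ _ h₁ h₂ => simp [ren, FV, h₁, h₂]
  | neg _ h => exact h
  | all z φ h | ex z φ h => simp [ren, FV, h, hσ.ne_iff]

theorem ren_subst {σ : Ind → Ind} (hσ : Function.Injective σ) (φ : FO Ω) (x y : Ind) :
    (φ.subst x y).ren σ σ = (φ.ren σ σ).subst (σ x) (σ y) := by
  induction φ with
  | eq | atom => simp [ren, subst, hσ.eq_iff, apply_ite σ]
  | and _ _ h₁ h₂ | or _ _ h₁ h₂ | imp _ _ h₁ h₂ => simp [ren, subst, h₁, h₂]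
  | neg _ h => simp [ren, subst, h]
  | all z φ h | ex z φ h =>
    simp only [ren, subst, hσ.eq_iff, Function.update_eq_self]
    split_ifs <;> simp [ren, h]

theorem Substitutable.ren {σ : Ind → Ind} (hσ : Function.Injective σ) {φ : FO Ω} {x y : Ind} (hs : Substitutable y x φ) :
    Substitutable (σ y) (σ x) (φ.ren σ σ) := by
  induction φ with
  | eq | atom => trivial
  | and _ _ h₁ h₂ | or _ _ h₁ h₂ | imp _ _ h₁ h₂ => exact ⟨h₁ hs.1, h₂ hs.2⟩
  | neg _ h => exact h hs
  | all z φ h =>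
    intro hmem
    have hs := hs ((mem_FV_ren hσ (all z φ) x).1 hmem)
    exact ⟨hσ.ne hs.1, by simpa using h hs.2⟩
  | ex z φ h =>
    intro hmem
    have hs := hs ((mem_FV_ren hσ (ex z φ) x).1 hmem)
    exact ⟨hσ.ne hs.1, by simpa using h hs.2⟩

end FO

-- Provability under renaming

theorem IsAxiom.ren {σ : Ind → Ind} (hσ : Function.Injective σ) {φ : FO Ω} (h : IsAxiom φ) :
    IsAxiom (φ.ren σ σ) := by
  cases h with
  | a9 x y φ hy =>
    simpa [FO.ren, ren_subst hσ] using IsAxiom.a9 (σ x) (σ y) (φ.ren σ σ) (hy.ren hσ)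
  | a10 x y φ hy =>
    simpa [FO.ren, ren_subst hσ] using IsAxiom.a10 (σ x) (σ y) (φ.ren σ σ) (hy.ren hσ)
  | a12 x y z φ hy hz =>
    simpa [FO.ren, ren_subst hσ] using
      IsAxiom.a12 (σ x) (σ y) (σ z) (φ.ren σ σ) (hy.ren hσ) (hz.ren hσ)
  | an5 x φ => simpa [FO.ren, FO.iff] using IsAxiom.an5 (σ x) (φ.ren σ σ)
  | an6 x φ => simpa [FO.ren, FO.iff] using IsAxiom.an6 (σ x) (φ.ren σ σ)
  | _ => constructor

theorem Provable.ren {σ : Ind → Ind} (hσ : Function.Injective σ) {φ : FO Ω} (h : Provable φ) :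
    Provable (φ.ren σ σ) := by
  induction h with
  | ax h => exact .ax (h.ren hσ)
  | mp _ _ ih₁ ih₂ => exact .mp ih₁ ih₂
  | rAll x y φ ψ hsub hψ hφ _ ih =>
    rw [← mem_FV_ren hσ] at hψ hφ
    simp only [FO.ren, Function.update_eq_self, ren_subst hσ] at ih hφ ⊢
    exact .rAll _ _ _ _ (hsub.ren hσ) hψ hφ ih
  | rEx x y φ ψ hsub hψ hφ _ ih =>
    rw [← mem_FV_ren hσ] at hψ hφ
    simp only [FO.ren, Function.update_eq_self, ren_subst hσ] at ih hφ ⊢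
    exact .rEx _ _ _ _ (hsub.ren hσ) hψ hφ ih

/-- Binders are shifted above every variable of the formula, one quantifier at a time. The bound on
the free variables is carried through the induction because it makes the shifted binder fresh. -/
theorem StrongEquiv.ren_bound {N : ℕ} (φ : FO Ω) (hN : ∀ x : ℕ, x ∈ φ.vars → x < N) :
    StrongEquiv (φ.ren (N + ·) id) φ ∧ ∀ x : ℕ, x ∈ φ.FV → x < N := by
  induction φ with
  | eq x y => exact ⟨.refl _, hN⟩
  | atom P hP x => exact ⟨.refl _, hN⟩
  | and φ ψ h₁ h₂ | or φ ψ h₁ h₂ | imp φ ψ h₁ h₂ =>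
    have h₁ := h₁ (fun x hx => hN x (by simp [vars, hx]))
    have h₂ := h₂ (fun x hx => hN x (by simp [vars, hx]))
    refine ⟨?_, by simp only [FV, Finset.mem_union]; rintro x (hx | hx); exacts [h₁.2 x hx, h₂.2 x hx]⟩
    first
    | exact h₁.1.and h₂.1
    | exact h₁.1.or h₂.1
    | exact h₁.1.imp h₂.1
  | neg φ h => exact ⟨(h hN).1.neg, (h hN).2⟩
  | all x φ h | ex x φ h =>
    have hx : (x : ℕ) < N := hN x (by simp [vars])
    obtain ⟨he, hFV⟩ := h (fun x hx => hN x (by simp [vars, hx]))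
    refine ⟨?_, fun z hz => hFV z (Finset.mem_of_mem_erase hz)⟩
    have hne (z : ℕ) : N + z ≠ x := fun h =>
      Nat.not_lt.2 (Nat.le_add_right N z) (h ▸ hx)
    have hsub := subst_ren (b := (N + ·)) (u := x) (N + x) φ id
      (fun z a hz => absurd hz (hne z))
    have hup : Function.update id x (N + x) = fun a => if id a = x then N + x else id a := by
      funext a; simp [Function.update_apply]
    have hs : Substitutable (N + x) x (φ.ren (N + ·) id) :=
      substitutable_ren hne φ id fun z a hz ha => ha.trans (Nat.add_left_cancel hz).symm
    have hy : N + x ∉ (φ.ren (N + ·) id).FV := fun hmem => by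
      have := FV_ren_subset φ id hmem
      rw [Finset.image_id] at this
      exact absurd (hFV _ this) (by omega)
    simp only [ren, hup, ← hsub]
    first
    | exact (StrongEquiv.all_rename hs hy (hne x).symm).trans (he.all x)
    | exact (StrongEquiv.ex_rename hs hy (hne x).symm).trans (he.ex x)

/-- One transposition puts `f N` right; injectivity keeps the earlier values untouched. -/
theorem exists_perm_leftInverse {f : ℕ → ℕ} (hf : Function.Injective f) (N : ℕ) :
    ∃ σ : Equiv.Perm ℕ, ∀ i < N, σ (f i) = i := by
  induction N with
  | zero => exact ⟨1, by simp⟩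
  | succ N ih =>
    obtain ⟨σ, hσ⟩ := ih
    refine ⟨Equiv.swap (σ (f N)) N * σ, fun i hi => ?_⟩
    rcases Nat.lt_succ_iff_lt_or_eq.1 hi with hi | rfl
    · have h₁ : i ≠ σ (f N) := by
        rw [← hσ i hi, σ.injective.ne_iff, hf.ne_iff]; exact hi.ne
      simp [hσ i hi, Equiv.swap_apply_of_ne_of_ne h₁ hi.ne]
    · simp

/-- Provability is reflected by a renaming that keeps the free and the bound variables apart. -/
theorem Provable.of_ren {b g : Ind → Ind} (hb : Function.Injective b) (hg : Function.Injective g)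
    (hgb : ∀ x y, g x ≠ b y) {φ : FO Ω} (h : Provable (φ.ren b g)) : Provable φ := by
  obtain ⟨N, hN⟩ : ∃ N : ℕ, ∀ x : ℕ, x ∈ φ.vars → x < N :=
    ⟨φ.vars.sup id + 1, fun x hx => Nat.lt_succ_of_le (Finset.le_sup (f := id) hx)⟩
  -- One injection lists the `g`-images of the variables below `N`, then the `b`-images. A
  -- permutation inverting it on `N + N` arguments restores the free variables and sends the binder
  -- `x` to `N + x`, the situation of `StrongEquiv.ren_bound`.
  have hf : Function.Injective fun i => if i < N then g i else b (i - N) := by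
    intro i j hij
    dsimp only at hij
    split_ifs at hij with h₁ h₂ h₂
    · exact hg hij
    · exact absurd hij (hgb _ _)
    · exact absurd hij.symm (hgb _ _)
    · have : i - N = j - N := hb hij
      omega
  obtain ⟨σ, hσ⟩ := exists_perm_leftInverse hf (N + N)
  have h₁ := h.ren σ.injective
  rw [ren_ren (b' := σ ∘ b) σ (fun _ => rfl),
    ren_congr (b' := (N + ·)) (g' := id) φ fun x hx => ?_] at h₁
  · exact .mp h₁ (StrongEquiv.ren_bound φ hN).1.mp
  · have hx : (x : ℕ) < N := hN x hx
    constructor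
    · simpa using hσ (N + x) (Nat.add_lt_add_left hx N)
    · simpa [hx] using hσ x (Nat.lt_add_right N hx)

/-! ### Countability of the language -/

/-- An injective numbering of the basic predicate letters. -/
def PiLetter.code : PiLetter → ℕ
  | .p n => n + 4
  | .S => 0
  | .O => 1
  | .E => 2
  | .R => 3

theorem PiLetter.code_injective : Function.Injective PiLetter.code := by
  intro P Q h
  cases P <;> cases Q <;> simp_all [PiLetter.code]

/-- An injective numbering of the predicate letters. -/
def Sign.code : Sign → ℕ
  | .base P => Nat.pair 0 P.code
  | .plus P => Nat.pair 1 P.code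
  | .minus P => Nat.pair 2 P.code
  | .eps => Nat.pair 3 0

theorem Sign.code_injective : Function.Injective Sign.code := by
  intro P Q h
  cases P <;> cases Q <;> simp_all [Sign.code, PiLetter.code_injective.eq_iff]

/-- An injective numbering of the formulas. -/
def FO.code : FO Ω → ℕ
  | eq x y => Nat.pair 0 (Nat.pair x y)
  | atom P _ x => Nat.pair 1 (Nat.pair P.code (Encodable.encode (List.ofFn x)))
  | and φ ψ => Nat.pair 2 (Nat.pair φ.code ψ.code)
  | or φ ψ => Nat.pair 3 (Nat.pair φ.code ψ.code)
  | imp φ ψ => Nat.pair 4 (Nat.pair φ.code ψ.code)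
  | neg φ => Nat.pair 5 φ.code
  | all x φ => Nat.pair 6 (Nat.pair x φ.code)
  | ex x φ => Nat.pair 7 (Nat.pair x φ.code)

theorem FO.code_injective : Function.Injective (FO.code (Ω := Ω)) := by
  intro φ
  induction φ with
  | atom P hP x =>
    intro ψ h
    cases ψ with
    | atom Q hQ y =>
      simp only [FO.code, Nat.pair_eq_pair, true_and, Sign.code_injective.eq_iff] at h
      obtain ⟨rfl, h⟩ := h
      rw [List.ofFn_injective (Encodable.encode_injective h)]
    | _ => simp [FO.code] at h
  | eq x y => intro ψ h; cases ψ <;> simp_all [FO.code]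
  | and φ ψ h₁ h₂ | or φ ψ h₁ h₂ | imp φ ψ h₁ h₂ =>
    intro χ h
    cases χ <;> simp [FO.code] at h
    rw [h₁ h.1, h₂ h.2]
  | neg φ h' =>
    intro χ h
    cases χ <;> simp [FO.code] at h
    rw [h' h]
  | all x φ h' | ex x φ h' =>
    intro χ h
    cases χ <;> simp [FO.code] at h
    rw [h.1, h' h.2]

instance : Countable (FO Ω) := FO.code_injective.countable

/-! ### Formulas whose free variables are parameters -/

/-- The parameters of level at most `k`: an increasing family of sets of even variables. -/
def levelVars (k : ℕ) : Set Ind := {x | ∃ i j, i ≤ k ∧ x = 2 * Nat.pair i j}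

theorem levelVars_mono {k l : ℕ} (h : k ≤ l) : levelVars k ⊆ levelVars l := by
  rintro x ⟨i, j, hi, rfl⟩
  exact ⟨i, j, hi.trans h, rfl⟩

theorem levelVars_ne_odd {k : ℕ} {y : Ind} (hy : y ∈ levelVars k) (x : ℕ) : y ≠ 2 * x + 1 := by
  obtain ⟨i, j, _, rfl⟩ := hy
  show (2 * Nat.pair i j : ℕ) ≠ 2 * x + 1
  omega

theorem exists_fresh (k : ℕ) (F : Finset Ind) :
    ∃ y ∈ levelVars (k + 1), y ∉ levelVars k ∧ y ∉ F := by
  have hinf : (Set.range fun j => 2 * Nat.pair (k + 1) j).Infinite :=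
    Set.infinite_range_of_injective fun i j h => by
      simpa using h
  obtain ⟨_, ⟨j, rfl⟩, hj⟩ := hinf.exists_notMem_finset F
  refine ⟨_, ⟨k + 1, j, le_rfl, rfl⟩, ?_, hj⟩
  rintro ⟨i, j', hi, h⟩
  have : k + 1 = i := by
    have := Nat.eq_of_mul_eq_mul_left two_pos h
    exact (Nat.pair_eq_pair.1 this).1
  omega

/-- All bound variables are odd. -/
def FO.OddBound : FO Ω → Prop
  | eq _ _ => True
  | atom _ _ _ => True
  | and φ ψ => φ.OddBound ∧ ψ.OddBound
  | or φ ψ => φ.OddBound ∧ ψ.OddBound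
  | imp φ ψ => φ.OddBound ∧ ψ.OddBound
  | neg φ => φ.OddBound
  | all x φ => (∃ z : ℕ, x = 2 * z + 1) ∧ φ.OddBound
  | ex x φ => (∃ z : ℕ, x = 2 * z + 1) ∧ φ.OddBound

theorem FO.OddBound.subst {φ : FO Ω} (h : φ.OddBound) (x y : Ind) : (φ.subst x y).OddBound := by
  induction φ with
  | eq | atom => trivial
  | and _ _ h₁ h₂ | or _ _ h₁ h₂ | imp _ _ h₁ h₂ => exact ⟨h₁ h.1, h₂ h.2⟩
  | neg _ h' => exact h' h
  | all z φ h' | ex z φ h' =>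
    simp only [FO.subst]
    split_ifs
    · exact h
    · exact ⟨h.1, h' h.2⟩

/-- Parameters are even and binders odd, so capture cannot occur. -/
theorem FO.OddBound.substitutable {φ : FO Ω} (h : φ.OddBound) (x : Ind) {k : ℕ} {y : Ind}
    (hy : y ∈ levelVars k) : Substitutable y x φ := by
  induction φ with
  | eq | atom => trivial
  | and _ _ h₁ h₂ | or _ _ h₁ h₂ | imp _ _ h₁ h₂ => exact ⟨h₁ h.1, h₂ h.2⟩
  | neg _ h' => exact h' h
  | all z φ h' | ex z φ h' =>
    obtain ⟨⟨z, rfl⟩, h⟩ := h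
    exact fun _ => ⟨(levelVars_ne_odd hy z).symm, h' h⟩

/-- An injection of the variables into the odd ones. -/
abbrev oddVar (x : Ind) : Ind := 2 * x + 1

theorem FO.oddBound_ren (φ : FO Ω) : ∀ g : Ind → Ind,
    (φ.ren oddVar g).OddBound := by
  induction φ with
  | eq | atom => intro g; trivial
  | and _ _ h₁ h₂ | or _ _ h₁ h₂ | imp _ _ h₁ h₂ => exact fun g => ⟨h₁ g, h₂ g⟩
  | neg _ h => exact h
  | all x φ h | ex x φ h => exact fun g => ⟨⟨x, rfl⟩, h _⟩

/-- The formulas whose bound variables are odd and whose free variables are parameters of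
level at most `k`. -/
structure Nice (k : ℕ) (φ : FO Ω) : Prop where
  odd : φ.OddBound
  free : ∀ x ∈ φ.FV, x ∈ levelVars k

namespace Nice

variable {k : ℕ} {φ ψ : FO Ω} {x y : Ind}

theorem mono {l : ℕ} (hkl : k ≤ l) (h : Nice k φ) : Nice l φ :=
  ⟨h.odd, fun x hx => levelVars_mono hkl (h.free x hx)⟩

theorem and_iff : Nice k (and φ ψ) ↔ Nice k φ ∧ Nice k ψ := by
  constructor
  · exact fun h => ⟨⟨h.odd.1, fun x hx => h.free x (Finset.mem_union_left _ hx)⟩,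
      ⟨h.odd.2, fun x hx => h.free x (Finset.mem_union_right _ hx)⟩⟩
  · exact fun h => ⟨⟨h.1.odd, h.2.odd⟩,
      fun x hx => (Finset.mem_union.1 hx).elim (h.1.free x) (h.2.free x)⟩

theorem or_iff : Nice k (or φ ψ) ↔ Nice k φ ∧ Nice k ψ :=
  Iff.trans ⟨fun h => ⟨h.odd, h.free⟩, fun h => ⟨h.odd, h.free⟩⟩ and_iff

theorem imp_iff : Nice k (imp φ ψ) ↔ Nice k φ ∧ Nice k ψ :=
  Iff.trans ⟨fun h => ⟨h.odd, h.free⟩, fun h => ⟨h.odd, h.free⟩⟩ and_iff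

theorem neg_iff : Nice k (neg φ) ↔ Nice k φ :=
  ⟨fun h => ⟨h.odd, h.free⟩, fun h => ⟨h.odd, h.free⟩⟩

theorem ex_iff : Nice k (ex x φ) ↔ Nice k (all x φ) :=
  ⟨fun h => ⟨h.odd, h.free⟩, fun h => ⟨h.odd, h.free⟩⟩

theorem all_neg_iff : Nice k (all x (neg φ)) ↔ Nice k (all x φ) :=
  ⟨fun h => ⟨h.odd, h.free⟩, fun h => ⟨h.odd, h.free⟩⟩

theorem subst (h : Nice k (all x φ)) (hy : y ∈ levelVars k) : Nice k (φ.subst x y) := by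
  refine ⟨h.odd.2.subst x y, fun z hz => ?_⟩
  rcases Finset.mem_insert.1 (FV_subst_subset x y φ hz) with rfl | hz
  · exact hy
  · exact h.free z hz

theorem ren (φ : FO Ω) {g : Ind → Ind} (hg : ∀ x, g x ∈ levelVars k) :
    Nice k (φ.ren oddVar g) := by
  refine ⟨φ.oddBound_ren g, fun z hz => ?_⟩
  obtain ⟨x, _, rfl⟩ := Finset.mem_image.1 (FV_ren_subset φ g hz)
  exact hg x

theorem eq (hx : x ∈ levelVars k) (hy : y ∈ levelVars k) : Nice k (eq x y : FO Ω) :=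
  ⟨trivial, by simp [FV, hx, hy]⟩

theorem atom {P : Sign} (hP : P ∈ Ω) {a : Fin P.arity → Ind} (ha : ∀ i, a i ∈ levelVars k) :
    Nice k (atom P hP a) :=
  ⟨trivial, by simp [FV, ha]⟩

theorem notMem_FV_of_fresh (h : Nice k (all x φ)) (hy : y ∈ levelVars (k + 1))
    (hyk : y ∉ levelVars k) : y ∉ φ.FV := by
  intro hmem
  obtain ⟨z, rfl⟩ := h.odd.1
  exact hyk (h.free y (Finset.mem_erase.2 ⟨levelVars_ne_odd hy z, hmem⟩))

end Nice

/-! ### Prime theories with witnesses -/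

/-- A deductively closed prime theory with witnesses among the parameters of a given level. -/
structure World (Ω : Set Sign) : Type where
  level : ℕ
  T : Set (FO Ω)
  nice : ∀ φ ∈ T, Nice level φ
  closed : ∀ φ, Nice level φ → Derivable T φ → φ ∈ T
  prime : ∀ φ ψ : FO Ω, or φ ψ ∈ T → φ ∈ T ∨ ψ ∈ T
  henkin : ∀ x φ, ex x φ ∈ T → ∃ y ∈ levelVars level, φ.subst x y ∈ T

/-- The sets of formulas of level `k + 1` that use finitely many parameters beyond level `k`
and derive no formula in `D`. -/
structure Admissible (k : ℕ) (D Γ : Set (FO Ω)) : Prop where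
  nice : ∀ γ ∈ Γ, Nice (k + 1) γ
  finite : ∃ F : Finset Ind, ∀ γ ∈ Γ, ∀ x ∈ γ.FV, x ∈ levelVars k ∨ x ∈ F
  con : ∀ δ ∈ D, ¬ Derivable Γ δ

theorem Admissible.insert {k : ℕ} {D Γ : Set (FO Ω)} (h : Admissible k D Γ) {φ : FO Ω}
    (hφ : Nice (k + 1) φ) (hcon : ∀ δ ∈ D, ¬ Derivable (insert φ Γ) δ) :
    Admissible k D (insert φ Γ) := by
  obtain ⟨F, hF⟩ := h.finite
  refine ⟨?_, ⟨F ∪ φ.FV, ?_⟩, hcon⟩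
  · rintro γ (rfl | hγ)
    · exact hφ
    · exact h.nice γ hγ
  · rintro γ (rfl | hγ) x hx
    · exact .inr (Finset.mem_union_right _ hx)
    · exact (hF γ hγ x hx).imp_right (Finset.mem_union_left _)

/-- One Lindenbaum–Henkin step: `φ` is added if no member of `D` becomes derivable, and an
existential formula is added together with a witness. Only finitely many parameters beyond level `k`
are in use, so a fresh one of level `k + 1` exists; it is not free in `D`, whose level is `k`. -/
theorem Admissible.exists_step {k : ℕ} {D Γ : Set (FO Ω)} (hD : ∀ δ ∈ D, Nice k δ)
    (h : Admissible k D Γ) (φ : FO Ω) :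
    ∃ Γ', Admissible k D Γ' ∧ Γ ⊆ Γ' ∧
      (Nice (k + 1) φ → φ ∉ Γ' → ∃ δ ∈ D, Derivable (Insert.insert φ Γ') δ) ∧
      (φ ∈ Γ' → ∀ x ψ, φ = ex x ψ → ∃ y ∈ levelVars (k + 1), ψ.subst x y ∈ Γ') := by
  by_cases hφ : Nice (k + 1) φ ∧ ∀ δ ∈ D, ¬ Derivable (Insert.insert φ Γ) δ
  · obtain ⟨hφ, hcon⟩ := hφ
    have h' := h.insert hφ hcon
    by_cases hex : ∃ x ψ, φ = ex x ψ
    · obtain ⟨x, ψ, rfl⟩ := hex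
      obtain ⟨F, hF⟩ := h'.finite
      obtain ⟨y, hy, hyk, hyF⟩ := exists_fresh k (F ∪ ψ.FV)
      simp only [Finset.mem_union, not_or] at hyF
      have hψ := Nice.ex_iff.1 hφ
      have hfresh : ∀ γ ∈ Insert.insert (ex x ψ) Γ, y ∉ γ.FV := fun γ hγ hmem =>
        (hF γ hγ y hmem).elim hyk hyF.1
      refine ⟨Insert.insert (ψ.subst x y) (Insert.insert (ex x ψ) Γ),
        h'.insert (hψ.subst hy) fun δ hδ hd => hcon δ hδ ?_,
        (Set.subset_insert _ _).trans (Set.subset_insert _ _),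
        fun _ hn => absurd (Set.mem_insert_of_mem _ (Set.mem_insert _ _)) hn, fun _ x' ψ' he => ?_⟩
      · exact .mp (.prem (.inl rfl)) (Derivable.ex_elim (hψ.odd.2.substitutable x hy) hfresh
          hyF.2 (fun hm => hyk ((hD δ hδ).free y hm)) hd)
      · cases he
        exact ⟨y, hy, Set.mem_insert _ _⟩
    · exact ⟨_, h', Set.subset_insert _ _, fun _ hn => absurd (Set.mem_insert _ _) hn,
        fun _ x ψ he => absurd ⟨x, ψ, he⟩ hex⟩
  · refine ⟨Γ, h, subset_rfl, fun hn _ => ?_, fun hmem x ψ he => ?_⟩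
    · by_contra hc
      exact hφ ⟨hn, fun δ hδ hd => hc ⟨δ, hδ, hd⟩⟩
    -- A formula already in `Γ` passes the test trivially, so in the rejecting case it cannot belong
    -- to `Γ`.
    · refine absurd ⟨h.nice φ hmem, ?_⟩ hφ
      rw [Set.insert_eq_of_mem hmem]
      exact h.con

theorem Derivable.exists_of_iUnion {Γ : ℕ → Set (FO Ω)} (hΓ : Monotone Γ) {φ : FO Ω}
    (d : Derivable (⋃ n, Γ n) φ) : ∃ n, Derivable (Γ n) φ := by
  induction d with
  | prem h =>
    obtain ⟨n, hn⟩ := Set.mem_iUnion.1 h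
    exact ⟨n, .prem hn⟩
  | thm h => exact ⟨0, .thm h⟩
  | mp _ _ ih₁ ih₂ =>
    obtain ⟨n, hn⟩ := ih₁
    obtain ⟨m, hm⟩ := ih₂
    exact ⟨max n m, .mp (hn.mono (hΓ (le_max_left n m))) (hm.mono (hΓ (le_max_right n m)))⟩

/-- A set `Γ` of formulas of level `k` that derives no formula in the directed set `D` extends
to a prime theory of level `k + 1` that contains no formula in `D`. -/
theorem exists_world {k : ℕ} {Γ D : Set (FO Ω)} (hΓ : ∀ γ ∈ Γ, Nice k γ)
    (hD : ∀ δ ∈ D, Nice k δ)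
    (hdir : ∀ δ ∈ D, ∀ δ' ∈ D, ∃ ε ∈ D, Provable (imp δ ε) ∧ Provable (imp δ' ε))
    (hcon : ∀ δ ∈ D, ¬ Derivable Γ δ) :
    ∃ w : World Ω, w.level = k + 1 ∧ Γ ⊆ w.T ∧ ∀ δ ∈ D, δ ∉ w.T := by
  have hne : Nonempty (FO Ω) := ⟨eq 0 0⟩
  obtain ⟨e, he⟩ := exists_surjective_nat (FO Ω)
  have h₀ : Admissible k D Γ :=
    ⟨fun γ hγ => (hΓ γ hγ).mono k.le_succ, ⟨∅, fun γ hγ x hx => .inl ((hΓ γ hγ).free x hx)⟩, hcon⟩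
  choose step hadm hsub hmax hwit using
    fun (G : {G : Set (FO Ω) // Admissible k D G}) (φ : FO Ω) => G.2.exists_step hD φ
  -- Each formula is treated when the enumeration reaches it. One visit is enough, since a rejected
  -- formula derives a member of `D` from every later stage too.
  let G : ℕ → {G : Set (FO Ω) // Admissible k D G} :=
    fun n => Nat.rec ⟨Γ, h₀⟩ (fun n G => ⟨step G (e n), hadm G (e n)⟩) n
  have hmono : Monotone fun n => (G n).1 := monotone_nat_of_le_succ fun n => hsub (G n) (e n)
  have hle (n : ℕ) : (G n).1 ⊆ ⋃ n, (G n).1 := Set.subset_iUnion (fun n => (G n).1) n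
  have hcon' : ∀ δ ∈ D, ¬ Derivable (⋃ n, (G n).1) δ := fun δ hδ hd => by
    obtain ⟨n, hn⟩ := hd.exists_of_iUnion hmono
    exact (G n).2.con δ hδ hn
  have hmax' (φ : FO Ω) (hφ : Nice (k + 1) φ) (hn : φ ∉ ⋃ n, (G n).1) :
      ∃ δ ∈ D, Derivable (Insert.insert φ (⋃ n, (G n).1)) δ := by
    obtain ⟨n, rfl⟩ := he φ
    obtain ⟨δ, hδ, hd⟩ := hmax (G n) (e n) hφ fun h => hn (hle (n + 1) h)
    exact ⟨δ, hδ, hd.mono (Set.insert_subset_insert (hle (n + 1)))⟩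
  have hnice : ∀ φ ∈ ⋃ n, (G n).1, Nice (k + 1) φ := fun φ hφ => by
    obtain ⟨n, hn⟩ := Set.mem_iUnion.1 hφ
    exact (G n).2.nice φ hn
  refine ⟨⟨k + 1, ⋃ n, (G n).1, hnice, fun φ hφ hd => ?_, fun φ ψ hor => ?_, fun x φ hex => ?_⟩,
    rfl, hle 0, fun δ hδ hmem => hcon' δ hδ (.prem hmem)⟩
  · by_contra hn
    obtain ⟨δ, hδ, hd'⟩ := hmax' φ hφ hn
    exact hcon' δ hδ (hd.cut hd')
  · by_contra! hn
    have hor' := Nice.or_iff.1 (hnice _ hor)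
    obtain ⟨δ₁, hδ₁, hd₁⟩ := hmax' φ hor'.1 hn.1
    obtain ⟨δ₂, hδ₂, hd₂⟩ := hmax' ψ hor'.2 hn.2
    -- Primeness is where directedness enters: if both disjuncts were rejected, the disjunction
    -- would derive a common upper bound in `D`.
    obtain ⟨ε, hε, hp₁, hp₂⟩ := hdir δ₁ hδ₁ δ₂ hδ₂
    exact hcon' ε hε (.mp (.prem hor) (Derivable.or_elim (hd₁.deduction.imp_trans (.thm hp₁))
      (hd₂.deduction.imp_trans (.thm hp₂))))
  · obtain ⟨n, hn⟩ := he (ex x φ)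
    -- A formula that belongs to the limit cannot have been rejected at its own stage, so it
    -- received its witness there.
    have hmem : ex x φ ∈ step (G n) (e n) := by
      by_contra hnot
      obtain ⟨δ, hδ, hd⟩ := hmax (G n) (e n) (hn ▸ hnice _ hex) (hn ▸ hnot)
      refine hcon' δ hδ (hd.mono (Set.insert_subset (hn ▸ hex) (hle (n + 1))))
    obtain ⟨y, hy, hy'⟩ := hwit (G n) (e n) (hn ▸ hmem) x φ hn
    exact ⟨y, hy, hle (n + 1) hy'⟩

theorem exists_world_of_not_derivable {k : ℕ} {Γ : Set (FO Ω)} {δ : FO Ω}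
    (hΓ : ∀ γ ∈ Γ, Nice k γ) (hδ : Nice k δ) (hcon : ¬ Derivable Γ δ) :
    ∃ w : World Ω, w.level = k + 1 ∧ Γ ⊆ w.T ∧ δ ∉ w.T := by
  obtain ⟨w, h₁, h₂, h₃⟩ := exists_world (D := {δ}) hΓ (by simpa using hδ)
    (by simpa using Provable.imp_self δ) (by simpa using hcon)
  exact ⟨w, h₁, h₂, h₃ δ rfl⟩

-- Membership in prime theories

namespace World

/-- The order of the prime theories. -/
def le (w v : World Ω) : Prop := w.level ≤ v.level ∧ w.T ⊆ v.T

variable {w v : World Ω} {φ ψ : FO Ω} {x y z : Ind}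

theorem le.vars (h : le w v) : levelVars w.level ⊆ levelVars v.level := levelVars_mono h.1

theorem mem_of_imp (hψ : Nice w.level ψ) (h : Provable (imp φ ψ)) (hφ : φ ∈ w.T) : ψ ∈ w.T :=
  w.closed ψ hψ (.mp (.prem hφ) (.thm h))

theorem mem_iff_of_isAxiom (h : IsAxiom (FO.iff φ ψ)) (hφ : Nice w.level φ)
    (hψ : Nice w.level ψ) : φ ∈ w.T ↔ ψ ∈ w.T :=
  ⟨mem_of_imp hψ (Provable.ax h).iff_mp, mem_of_imp hφ (Provable.ax h).iff_mpr⟩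

theorem and_mem : and φ ψ ∈ w.T ↔ φ ∈ w.T ∧ ψ ∈ w.T := by
  constructor
  · intro h
    have hn := Nice.and_iff.1 (w.nice _ h)
    exact ⟨mem_of_imp hn.1 (.ax (.a3 _ _)) h, mem_of_imp hn.2 (.ax (.a4 _ _)) h⟩
  · intro h
    exact w.closed _ (Nice.and_iff.2 ⟨w.nice _ h.1, w.nice _ h.2⟩)
      ((Derivable.prem h.1).and_intro (.prem h.2))

theorem or_mem (hφ : Nice w.level φ) (hψ : Nice w.level ψ) :
    or φ ψ ∈ w.T ↔ φ ∈ w.T ∨ ψ ∈ w.T := by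
  have hn := Nice.or_iff.2 ⟨hφ, hψ⟩
  refine ⟨w.prime φ ψ, ?_⟩
  rintro (h | h)
  · exact mem_of_imp hn (.ax (.a6 _ _)) h
  · exact mem_of_imp hn (.ax (.a7 _ _)) h

/-- By the deduction theorem, an implication missing from the theory leaves the conclusion
underivable after adding the antecedent; a world extending that set refutes it. -/
theorem imp_mem (hφ : Nice w.level φ) (hψ : Nice w.level ψ) :
    imp φ ψ ∈ w.T ↔ ∀ v, le w v → φ ∈ v.T → ψ ∈ v.T := by
  constructor
  · intro h v hwv hv
    exact v.closed _ (hψ.mono hwv.1) (.mp (.prem hv) (.prem (hwv.2 h)))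
  · intro h
    by_contra hn
    have hcon : ¬ Derivable (insert φ w.T) ψ := fun hd =>
      hn (w.closed _ (Nice.imp_iff.2 ⟨hφ, hψ⟩) hd.deduction)
    obtain ⟨v, hv, hsub, hnot⟩ := exists_world_of_not_derivable
      (by rintro γ (rfl | hγ); exacts [hφ, w.nice γ hγ]) hψ hcon
    exact hnot (h v ⟨by omega, (Set.subset_insert _ _).trans hsub⟩ (hsub (Set.mem_insert _ _)))

theorem ex_mem (hφ : Nice w.level (all x φ)) :
    ex x φ ∈ w.T ↔ ∃ y ∈ levelVars w.level, φ.subst x y ∈ w.T := by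
  refine ⟨w.henkin x φ, ?_⟩
  rintro ⟨y, hy, h⟩
  exact mem_of_imp (Nice.ex_iff.2 hφ) (.ax (.a10 x y φ (hφ.odd.2.substitutable x hy))) h

theorem all_mem (hφ : Nice w.level (all x φ)) :
    all x φ ∈ w.T ↔ ∀ v, le w v → ∀ y ∈ levelVars v.level, φ.subst x y ∈ v.T := by
  constructor
  · intro h v hwv y hy
    exact mem_of_imp ((hφ.mono hwv.1).subst hy)
      (.ax (.a9 x y φ (hφ.odd.2.substitutable x hy))) (hwv.2 h)
  · intro h
    by_contra hn
    -- A parameter of the next level serves as eigenvariable: it is free in no formula of the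
    -- theory, so deriving its instance would derive the universal formula.
    obtain ⟨y, hy, hyk, -⟩ := exists_fresh w.level ∅
    have hcon : ¬ Derivable w.T (φ.subst x y) := fun hd =>
      hn (w.closed _ hφ (.all_intro (hφ.odd.2.substitutable x hy)
        (fun γ hγ hmem => hyk ((w.nice γ hγ).free y hmem)) (hφ.notMem_FV_of_fresh hy hyk) hd))
    obtain ⟨v, hv, hsub, hnot⟩ := exists_world_of_not_derivable (k := w.level + 1)
      (fun γ hγ => (w.nice γ hγ).mono (Nat.le_succ _))
      ((hφ.mono (Nat.le_succ _)).subst hy) hcon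
    have hlev : w.level + 1 ≤ v.level := by omega
    exact hnot (h v ⟨by omega, hsub⟩ y (levelVars_mono hlev hy))

theorem subst_mem_of_eq_mem (hyz : eq y z ∈ w.T) (hφ : φ.OddBound)
    (hn : Nice w.level (φ.subst x z)) (h : φ.subst x y ∈ w.T) : φ.subst x z ∈ w.T := by
  have hyz' := (w.nice _ hyz).free
  simp only [FV, Finset.mem_insert, Finset.mem_singleton, forall_eq_or_imp, forall_eq] at hyz'
  exact w.closed _ hn (.mp (.prem h) (.mp (.prem hyz) (.thm (.ax (.a12 x y z φ
    (hφ.substitutable x hyz'.1) (hφ.substitutable x hyz'.2))))))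

/-- The parameters available at `w`. -/
abbrev Param (w : World Ω) : Type := {x : Ind // x ∈ levelVars w.level}

theorem eq_refl (a : w.Param) : eq a.1 a.1 ∈ w.T :=
  w.closed _ (.eq a.2 a.2) (.thm (.ax (.a11 _)))

/-- The odd variable `1` marks the place of replacement; no parameter coincides with it. -/
theorem subst_var_left {k : ℕ} {a : Ind} (b : Ind) (ha : a ∈ levelVars k) :
    (eq 1 a : FO Ω).subst 1 b = eq b a := by
  have := levelVars_ne_odd ha 0
  simp_all [FO.subst]

theorem subst_var_right {k : ℕ} {a : Ind} (b : Ind) (ha : a ∈ levelVars k) :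
    (eq a 1 : FO Ω).subst 1 b = eq a b := by
  have := levelVars_ne_odd ha 0
  simp_all [FO.subst]

theorem eq_symm {a b : w.Param} (h : eq a.1 b.1 ∈ w.T) : eq b.1 a.1 ∈ w.T := by
  have := subst_mem_of_eq_mem (x := 1) (φ := eq 1 a.1) h trivial
  simp only [subst_var_left _ a.2] at this
  exact this (.eq b.2 a.2) (eq_refl a)

theorem eq_trans {a b c : w.Param} (h₁ : eq a.1 b.1 ∈ w.T) (h₂ : eq b.1 c.1 ∈ w.T) :
    eq a.1 c.1 ∈ w.T := by
  have := subst_mem_of_eq_mem (x := 1) (φ := eq a.1 1) h₂ trivial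
  simp only [subst_var_right _ a.2] at this
  exact this (.eq a.2 c.2) h₁

theorem subst_neg (φ : FO Ω) (x y : Ind) : (neg φ).subst x y = neg (φ.subst x y) := rfl

theorem neg_eq_congr {a b a' b' : w.Param} (ha : eq a.1 a'.1 ∈ w.T) (hb : eq b.1 b'.1 ∈ w.T)
    (h : neg (eq a.1 b.1) ∈ w.T) : neg (eq a'.1 b'.1) ∈ w.T := by
  have h₁ := subst_mem_of_eq_mem (x := 1) (φ := neg (eq 1 b.1)) ha trivial
  have h₂ := subst_mem_of_eq_mem (x := 1) (φ := neg (eq a'.1 1)) hb trivial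
  simp only [subst_neg, subst_var_left _ b.2] at h₁
  simp only [subst_neg, subst_var_right _ a'.2] at h₂
  exact h₂ (Nice.neg_iff.2 (.eq a'.2 b'.2)) (h₁ (Nice.neg_iff.2 (.eq a'.2 b.2)) h)

/-- Membership of literals is invariant under provably equal parameters. -/
theorem literal_congr {P : Sign} (hP : P ∈ Ω) (C : FO Ω → FO Ω)
    (hC : ∀ φ x y, (C φ).subst x y = C (φ.subst x y)) (hodd : ∀ φ, φ.OddBound → (C φ).OddBound)
    (hnice : ∀ φ, Nice w.level φ → Nice w.level (C φ)) {a b : Fin P.arity → w.Param}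
    (hab : ∀ i, eq (a i).1 (b i).1 ∈ w.T) (h : C (atom P hP fun i => (a i).1) ∈ w.T) :
    C (atom P hP fun i => (b i).1) ∈ w.T := by
  suffices ∀ s : Finset (Fin P.arity), C (atom P hP fun i => (s.piecewise b a i).1) ∈ w.T by
    simpa using this Finset.univ
  intro s
  -- The equality axiom replaces one term at a time, so the arguments in `s` are exchanged one by
  -- one.
  induction s using Finset.induction_on with
  | empty => simpa using h
  | insert i s hi ih =>
    have hsub (c : w.Param) :
        (atom P hP (Function.update (fun j => (s.piecewise b a j).1) i 1)).subst 1 c.1 =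
          atom P hP fun j => (Function.update (s.piecewise b a) i c j).1 := by
      simp only [FO.subst]
      congr 1
      funext j
      by_cases hj : j = i
      · subst hj; simp
      · have : (s.piecewise b a j).1 ≠ 1 := levelVars_ne_odd (s.piecewise b a j).2 0
        simp [hj, this]
    have key := subst_mem_of_eq_mem (x := 1)
      (φ := C (atom P hP (Function.update (fun j => (s.piecewise b a j).1) i 1))) (hab i)
      (hodd _ trivial)
    simp only [hC, hsub] at key
    rw [Finset.piecewise_insert]
    refine key (hnice _ (.atom hP fun j => (Function.update (s.piecewise b a) i (b i) j).2)) ?_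
    have : Function.update (s.piecewise b a) i (a i) = s.piecewise b a := by
      rw [Function.update_eq_self_iff]; simp [hi]
    rwa [this]

theorem atom_congr {P : Sign} (hP : P ∈ Ω) {a b : Fin P.arity → w.Param}
    (hab : ∀ i, eq (a i).1 (b i).1 ∈ w.T) (h : atom P hP (fun i => (a i).1) ∈ w.T) :
    atom P hP (fun i => (b i).1) ∈ w.T :=
  literal_congr hP id (fun _ _ _ => rfl) (fun _ => id) (fun _ => id) hab h

theorem neg_atom_congr {P : Sign} (hP : P ∈ Ω) {a b : Fin P.arity → w.Param}
    (hab : ∀ i, eq (a i).1 (b i).1 ∈ w.T) (h : neg (atom P hP (fun i => (a i).1)) ∈ w.T) :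
    neg (atom P hP (fun i => (b i).1)) ∈ w.T :=
  literal_congr hP neg (fun _ _ _ => rfl) (fun _ => id) (fun _ => Nice.neg_iff.2) hab h

/-- Provable equality of parameters. -/
instance paramSetoid (w : World Ω) : Setoid w.Param where
  r a b := eq a.1 b.1 ∈ w.T
  iseqv := ⟨eq_refl, eq_symm, eq_trans⟩

/-- The domain at `w`: the parameters up to provable equality. -/
def Dom (w : World Ω) : Type u := ULift.{u} (Quotient w.paramSetoid)

/-- The element of the domain denoted by a parameter. -/
def den (w : World Ω) (a : w.Param) : w.Dom := ULift.up (Quotient.mk _ a)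

theorem den_eq_iff {a b : w.Param} : w.den a = w.den b ↔ eq a.1 b.1 ∈ w.T :=
  ULift.up_inj.trans Quotient.eq

theorem den_surjective (w : World Ω) : Function.Surjective w.den := by
  rintro ⟨a⟩
  obtain ⟨a, rfl⟩ := Quotient.exists_rep a
  exact ⟨a, rfl⟩

/-- The inclusion of the parameters. -/
def incl (h : le w v) (a : w.Param) : v.Param := ⟨a.1, h.vars a.2⟩

/-- The transition map of the domains. -/
def trans (h : le w v) (a : w.Dom) : v.Dom :=
  ULift.up (Quotient.map (incl h) (fun _ _ hab => h.2 hab) a.down)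

/-- The negated literals of a theory; those of equality interpret `eps`. -/
inductive NegLiteral (w : World Ω) : (P : Sign) → (Fin P.arity → w.Param) → Prop
  | atom (P : Sign) (hP : P ∈ Ω) (a : Fin P.arity → w.Param)
      (h : neg (atom P hP fun i => (a i).1) ∈ w.T) : NegLiteral w P a
  | eps (a : Fin 2 → w.Param) (h : neg (eq (a 0).1 (a 1).1) ∈ w.T) : NegLiteral w Sign.eps a

theorem NegLiteral.incl (h : le w v) {P : Sign} {a : Fin P.arity → w.Param}
    (ha : NegLiteral w P a) : NegLiteral v P (fun i => World.incl h (a i)) := by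
  cases ha with
  | atom P hP a ha => exact .atom P hP _ (h.2 ha)
  | eps a ha => exact .eps (fun i => World.incl h (a i)) (h.2 ha)

end World

/-! ### The canonical sheaf -/

/-- The canonical sheaf, given one prime theory. -/
def canonicalSheaf (w₀ : World Ω) : NelsonSheaf.{u} Ω where
  W := ULift.{u} (World Ω)
  nonempty := ⟨⟨w₀⟩⟩
  le w v := World.le w.down v.down
  refl _ := ⟨le_rfl, subset_rfl⟩
  trans h h' := ⟨h.1.trans h'.1, h.2.trans h'.2⟩
  U w := w.down.Dom
  -- The parameters of level `0` are available at every world.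
  U_nonempty w := ⟨w.down.den ⟨_, 0, 0, Nat.zero_le _, rfl⟩⟩
  posRel w P hP := {d | ∃ a : Fin P.arity → w.down.Param,
    d = (fun i => w.down.den (a i)) ∧ atom P hP (fun i => (a i).1) ∈ w.down.T}
  negRel w P _ := {d | ∃ a : Fin P.arity → w.down.Param,
    d = (fun i => w.down.den (a i)) ∧ w.down.NegLiteral P a}
  H h := World.trans h
  H_pos := by
    rintro w v h P hP _ ⟨a, rfl, ha⟩
    exact ⟨fun i => World.incl h (a i), rfl, h.2 ha⟩
  H_neg := by
    rintro w v h P hP _ ⟨a, rfl, ha⟩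
    exact ⟨fun i => World.incl h (a i), rfl, ha.incl h⟩
  H_id := by
    intro w a
    obtain ⟨a, rfl⟩ := w.down.den_surjective a
    rfl
  H_comp := by
    intro w v t h h' a
    obtain ⟨a, rfl⟩ := w.down.den_surjective a
    rfl

/-! ### The truth lemma -/

/-- Instantiating the renamed matrix agrees with sending the quantified variable directly to the
parameter, because `g` takes no odd value. -/
theorem FO.ren_update_subst {k : ℕ} {g : Ind → Ind} (hg : ∀ i, g i ∈ levelVars k) (x y : Ind)
    (φ : FO Ω) : (φ.ren oddVar (Function.update g x (oddVar x))).subst (oddVar x) y =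
      φ.ren oddVar (Function.update g x y) := by
  have hne (a : Ind) : g a ≠ oddVar x := levelVars_ne_odd (hg a) x
  rw [subst_ren]
  · congr 1
    funext a
    by_cases ha : a = x
    · simp [ha]
    · simp only [Function.update_of_ne ha, if_neg (hne a)]
  · intro z a hz ha
    have hzx : z = x := by
      have : 2 * z + 1 = 2 * x + 1 := hz
      exact Nat.eq_of_mul_eq_mul_left two_pos (Nat.succ_injective this)
    by_contra hax
    rw [Function.update_of_ne (hzx ▸ hax)] at ha
    exact hne a ha

theorem World.update_den {w : World Ω} (g : Ind → w.Param) (x : Ind) (a : w.Param) :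
    Function.update (fun i => w.den (g i)) x (w.den a) =
      fun i => w.den (Function.update g x a i) := by
  funext i
  by_cases hi : i = x
  · subst hi; simp
  · simp [hi]

theorem World.ren_update_param {w : World Ω} (g : Ind → w.Param) (x : Ind) (a : w.Param)
    (φ : FO Ω) :
    φ.ren oddVar (fun i => (Function.update g x a i).1) =
      (φ.ren oddVar (Function.update (fun i => (g i).1) x (oddVar x))).subst (oddVar x) a.1 := by
  rw [ren_update_subst (fun i => (g i).2)]
  congr 1
  funext i
  by_cases hi : i = x
  · subst hi; simp
  · simp [hi]

section Truth

variable (w₀ : World Ω)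

/-- Positive satisfaction in the canonical sheaf. -/
def CanonicalPos (φ : FO Ω) (w : World Ω) (f : Ind → w.Dom) : Prop :=
  (canonicalSheaf.{u} w₀).SatPos φ ⟨w⟩ f

/-- Negative satisfaction in the canonical sheaf. -/
def CanonicalNeg (φ : FO Ω) (w : World Ω) (f : Ind → w.Dom) : Prop :=
  (canonicalSheaf.{u} w₀).SatNeg φ ⟨w⟩ f

/-- Truth of `φ` at `w` amounts to membership of the renamed formula, both positively and
negatively. -/
def TruthAt (φ : FO Ω) (w : World Ω) (g : Ind → w.Param) : Prop :=
  (CanonicalPos.{u} w₀ φ w (fun i => w.den (g i)) ↔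
      φ.ren oddVar (fun i => (g i).1) ∈ w.T) ∧
  (CanonicalNeg.{u} w₀ φ w (fun i => w.den (g i)) ↔
      neg (φ.ren oddVar (fun i => (g i).1)) ∈ w.T)

variable {w₀} {w : World Ω}

/-- Serves positive `∃` and negative `∀` alike; every element is denoted by a parameter, so
witnesses in the domain and in the theory correspond. -/
theorem exists_sat_iff {sat : w.Dom → Prop} {x : Ind} {ψ : FO Ω}
    (hn : Nice w.level (all x ψ)) (h : ∀ a, sat (w.den a) ↔ ψ.subst x a.1 ∈ w.T) :
    (∃ d, sat d) ↔ ex x ψ ∈ w.T := by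
  rw [World.ex_mem hn, w.den_surjective.exists]
  constructor
  · rintro ⟨a, ha⟩
    exact ⟨a.1, a.2, (h a).1 ha⟩
  · rintro ⟨y, hy, h'⟩
    exact ⟨⟨y, hy⟩, (h ⟨y, hy⟩).2 h'⟩

/-- The counterpart for positive `∀` and negative `∃`, with later worlds taken into account. -/
theorem forall_sat_iff {sat : (v : World Ω) → World.le w v → v.Dom → Prop} {x : Ind} {ψ : FO Ω}
    (hn : Nice w.level (all x ψ))
    (h : ∀ v hv a, sat v hv (v.den a) ↔ ψ.subst x a.1 ∈ v.T) :
    (∀ (v : ULift.{u} (World Ω)) (hv : World.le w v.down) (d : v.down.Dom), sat v.down hv d) ↔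
      all x ψ ∈ w.T := by
  rw [World.all_mem hn]
  constructor
  · exact fun h' v hv y hy => (h v hv ⟨y, hy⟩).1 (h' ⟨v⟩ hv _)
  · intro h' v hv d
    obtain ⟨a, rfl⟩ := v.down.den_surjective d
    exact (h _ hv a).2 (h' _ hv _ a.2)

/-- The two polarities go through one induction, since `∼` and negative `→` mix them. Each negative
clause for a compound becomes a membership statement through the matching axiom `an1`–`an6`. -/
theorem truthAt (hΩ : Sign.eps ∉ Ω) (φ : FO Ω) :
    ∀ (w : World Ω) (g : Ind → w.Param), TruthAt.{u} w₀ φ w g := by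
  induction φ with
  | eq x y =>
    intro w g
    refine ⟨World.den_eq_iff, ?_⟩
    constructor
    · rintro ⟨a, hd, ha⟩
      cases ha with
      -- As `eps` lies outside the signature, its negative interpretation comes from negated
      -- equations alone.
      | atom _ hP _ _ => exact absurd hP hΩ
      | eps a ha =>
        exact World.neg_eq_congr (World.den_eq_iff.1 (congrFun hd (0 : Fin 2)).symm)
          (World.den_eq_iff.1 (congrFun hd (1 : Fin 2)).symm) ha
    · intro h
      refine ⟨![g x, g y], ?_, .eps ![g x, g y] h⟩
      funext (i : Fin 2)
      fin_cases i <;> rfl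
  | atom P hP x =>
    intro w g
    constructor
    · constructor
      · rintro ⟨a, hd, ha⟩
        exact World.atom_congr hP (b := fun i => g (x i))
          (fun i => World.den_eq_iff.1 (congrFun hd i).symm) ha
      · exact fun h => ⟨fun i => g (x i), rfl, h⟩
    · constructor
      · rintro ⟨a, hd, ha⟩
        cases ha with
        | atom _ _ _ ha =>
          exact World.neg_atom_congr hP (b := fun i => g (x i))
            (fun i => World.den_eq_iff.1 (congrFun hd i).symm) ha
        | eps a ha => exact absurd hP hΩ
      · exact fun h => ⟨fun i => g (x i), rfl, .atom P hP _ h⟩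
  | and φ ψ h₁ h₂ =>
    intro w g
    have hφ := Nice.ren φ fun i => (g i).2
    have hψ := Nice.ren ψ fun i => (g i).2
    refine ⟨(and_congr (h₁ w g).1 (h₂ w g).1).trans World.and_mem.symm,
      (or_congr (h₁ w g).2 (h₂ w g).2).trans ?_⟩
    rw [← World.or_mem (Nice.neg_iff.2 hφ) (Nice.neg_iff.2 hψ)]
    exact (World.mem_iff_of_isAxiom (.an2 _ _) (Nice.neg_iff.2 (Nice.and_iff.2 ⟨hφ, hψ⟩))
      (Nice.or_iff.2 ⟨Nice.neg_iff.2 hφ, Nice.neg_iff.2 hψ⟩)).symm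
  | or φ ψ h₁ h₂ =>
    intro w g
    have hφ := Nice.ren φ fun i => (g i).2
    have hψ := Nice.ren ψ fun i => (g i).2
    refine ⟨(or_congr (h₁ w g).1 (h₂ w g).1).trans (World.or_mem hφ hψ).symm,
      (and_congr (h₁ w g).2 (h₂ w g).2).trans ?_⟩
    rw [← World.and_mem]
    exact (World.mem_iff_of_isAxiom (.an3 _ _) (Nice.neg_iff.2 (Nice.or_iff.2 ⟨hφ, hψ⟩))
      (Nice.and_iff.2 ⟨Nice.neg_iff.2 hφ, Nice.neg_iff.2 hψ⟩)).symm
  | imp φ ψ h₁ h₂ =>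
    intro w g
    have hφ := Nice.ren φ fun i => (g i).2
    have hψ := Nice.ren ψ fun i => (g i).2
    constructor
    · refine ((canonicalSheaf w₀).satPos_imp.trans ?_).trans (World.imp_mem hφ hψ).symm
      constructor
      · intro h v hv hv'
        have k₁ := (h₁ v (fun i => World.incl hv (g i))).1
        have k₂ := (h₂ v (fun i => World.incl hv (g i))).1
        exact k₂.1 (h ⟨v⟩ hv (k₁.2 hv'))
      · intro h v hv hv'
        have k₁ := (h₁ v.down (fun i => World.incl hv (g i))).1
        have k₂ := (h₂ v.down (fun i => World.incl hv (g i))).1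
        exact k₂.2 (h v.down hv (k₁.1 hv'))
    · refine (and_congr (h₁ w g).1 (h₂ w g).2).trans ?_
      rw [← World.and_mem]
      exact (World.mem_iff_of_isAxiom (.an4 _ _) (Nice.neg_iff.2 (Nice.imp_iff.2 ⟨hφ, hψ⟩))
        (Nice.and_iff.2 ⟨hφ, Nice.neg_iff.2 hψ⟩)).symm
  | neg φ h =>
    intro w g
    have hφ := Nice.ren φ fun i => (g i).2
    exact ⟨(h w g).2, (h w g).1.trans
      (World.mem_iff_of_isAxiom (.an1 _) (Nice.neg_iff.2 (Nice.neg_iff.2 hφ)) hφ).symm⟩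
  | all x φ h =>
    intro w g
    have hn := Nice.ren (all x φ) fun i => (g i).2
    constructor
    · refine forall_sat_iff (sat := fun v hv d => CanonicalPos.{u} w₀ φ v
        (Function.update (fun i => v.den (World.incl hv (g i))) x d)) hn fun v hv a => ?_
      rw [World.update_den]
      refine (h v _).1.trans ?_
      rw [World.ren_update_param]
      rfl
    · refine Iff.trans ?_ (World.mem_iff_of_isAxiom (.an6 _ _) (Nice.neg_iff.2 hn)
        (Nice.ex_iff.2 (Nice.all_neg_iff.2 hn))).symm
      refine exists_sat_iff (sat := fun d => CanonicalNeg.{u} w₀ φ w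
        (Function.update (fun i => w.den (g i)) x d)) (Nice.all_neg_iff.2 hn) fun a => ?_
      rw [World.update_den]
      refine (h w _).2.trans ?_
      rw [World.ren_update_param]
      rfl
  | ex x φ h =>
    intro w g
    have hn := Nice.ren (all x φ) fun i => (g i).2
    constructor
    · refine exists_sat_iff (sat := fun d => CanonicalPos.{u} w₀ φ w
        (Function.update (fun i => w.den (g i)) x d)) hn fun a => ?_
      rw [World.update_den]
      refine (h w _).1.trans ?_
      rw [World.ren_update_param]
    · refine Iff.trans ?_ (World.mem_iff_of_isAxiom (.an5 _ _)
        (Nice.neg_iff.2 (Nice.ex_iff.2 hn)) (Nice.all_neg_iff.2 hn)).symm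
      refine forall_sat_iff (sat := fun v hv d => CanonicalNeg.{u} w₀ φ v
        (Function.update (fun i => v.den (World.incl hv (g i))) x d)) (Nice.all_neg_iff.2 hn)
        fun v hv a => ?_
      rw [World.update_den]
      refine (h v _).2.trans ?_
      rw [World.ren_update_param]
      rfl

end Truth

/-! ### Completeness -/

/-- An injection of the variables into the parameters of level `0`. -/
def rootVar (x : Ind) : Ind := 2 * Nat.pair 0 x

theorem rootVar_mem (x : Ind) : rootVar x ∈ levelVars 0 := ⟨0, x, le_rfl, rfl⟩

theorem rootVar_injective : Function.Injective rootVar := fun x y h => by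
  simpa using Nat.eq_of_mul_eq_mul_left two_pos h

theorem oddVar_injective : Function.Injective oddVar := fun _ _ h =>
  Nat.eq_of_mul_eq_mul_left two_pos (Nat.succ_injective h)

/-- Reflection is known for provable formulas only, so the derivation is compressed to a single
premise, chosen as the renaming of a formula derivable from `Γ`. -/
theorem Derivable.of_ren {Γ : Set (FO Ω)} {χ : FO Ω}
    (d : Derivable ((fun γ : FO Ω => γ.ren oddVar rootVar) '' Γ) (χ.ren oddVar rootVar)) :
    Derivable Γ χ := by
  obtain ⟨_, ⟨γ, hγ, rfl⟩, _, hp⟩ := d.exists_provable_imp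
    (fun γ => ∃ γ' : FO Ω, Derivable Γ γ' ∧ γ = γ'.ren oddVar rootVar)
    (by rintro _ ⟨γ, hγ, rfl⟩; exact ⟨γ, .prem hγ, rfl⟩) (.all_eq_self 1)
    -- The renaming turns the binder `0` into `oddVar 0`, that is `1`.
    ⟨all 0 (eq 0 0), .thm (.all_eq_self 0), rfl⟩
    (by
      rintro _ _ ⟨φ, hφ, rfl⟩ ⟨ψ, hψ, rfl⟩
      exact ⟨and φ ψ, hφ.and_intro hψ, rfl⟩)
  exact .mp hγ (.thm (Provable.of_ren (φ := imp γ χ) oddVar_injective rootVar_injective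
    (fun x y => levelVars_ne_odd (rootVar_mem x) y) hp))

theorem FO.ren_disj (b g : Ind → Ind) (θ : FO Ω) (l : List (FO Ω)) :
    (disj θ l).ren b g = disj (θ.ren b g) (l.map (·.ren b g)) := by
  induction l generalizing θ with
  | nil => rfl
  | cons a l ih => exact ih (or θ a)

theorem inducedLogic_subset_QN4 (hΩ : Sign.eps ∉ Ω) :
    inducedLogic (nelsonSemantics.{u} Ω) ⊆ QN4 Ω := by
  rintro ⟨Γ, Δ⟩ hind
  by_contra hnot
  obtain ⟨w, -, hΓ, hΔ⟩ := exists_world (k := 0)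
    (Γ := (fun γ : FO Ω => γ.ren oddVar rootVar) '' Γ)
    (D := {δ | ∃ (θ : FO Ω) (l : List (FO Ω)), θ ∈ Δ ∧ (∀ χ ∈ l, χ ∈ Δ) ∧
      δ = (disj θ l).ren oddVar rootVar})
    (by rintro _ ⟨γ, _, rfl⟩; exact .ren γ rootVar_mem)
    (by rintro _ ⟨θ, l, _, _, rfl⟩; exact .ren _ rootVar_mem)
    (by
      rintro _ ⟨θ, l, hθ, hl, rfl⟩ _ ⟨θ', l', hθ', hl', rfl⟩
      -- Taking all finite disjunctions of members of `Δ` makes the avoided set directed: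
      -- concatenated lists give an upper bound.
      refine ⟨_, ⟨θ, l ++ θ' :: l', hθ, ?_, rfl⟩, ?_, ?_⟩
      · intro χ hχ
        rcases List.mem_append.1 hχ with hχ | hχ
        · exact hl χ hχ
        · rcases List.mem_cons.1 hχ with rfl | hχ
          · exact hθ'
          · exact hl' χ hχ
      all_goals
        rw [ren_disj, ren_disj]
        refine Derivable.provable (disj_imp_iff.2 ⟨imp_disj ?_, fun ψ hψ => imp_disj ?_⟩)
      · exact .inl rfl
      · right; simp only [List.map_append, List.mem_append]; exact .inl hψ
      · right; simp
      · right; simp only [List.map_append, List.mem_append, List.map_cons]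
        exact .inr (List.mem_cons_of_mem _ hψ))
    (by
      rintro _ ⟨θ, l, hθ, hl, rfl⟩ hd
      exact hnot ⟨θ, l, hθ, hl, hd.of_ren⟩)
  have hw (x : Ind) : rootVar x ∈ levelVars w.level := levelVars_mono (Nat.zero_le _) (rootVar_mem x)
  have htruth (φ : FO Ω) := (truthAt.{u} (w₀ := w) hΩ φ w fun i => ⟨rootVar i, hw i⟩).1
  refine hind ⟨⟨canonicalSheaf w, ⟨w⟩, fun i => w.den ⟨rootVar i, hw i⟩⟩, fun φ hφ => ?_,
    fun ψ hψ hsat => ?_⟩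
  · exact (htruth φ).2 (hΓ ⟨φ, hφ, rfl⟩)
  -- A single member of `Δ` is the disjunction with empty tail.
  · exact hΔ _ ⟨ψ, [], hψ, by simp, rfl⟩ ((htruth ψ).1 hsat)

end NelsonFO

theorem proposition6 (Ω : Set NelsonFO.Sign) (hΩ : Ω ⊆ NelsonFO.PiSet) :
    NelsonFO.QN4 Ω = NelsonFO.inducedLogic (NelsonFO.nelsonSemantics.{u} Ω) :=
  (NelsonFO.QN4_subset_inducedLogic Ω).antisymm
    (NelsonFO.inducedLogic_subset_QN4 fun h => by
      obtain ⟨P, hP⟩ := hΩ h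
      cases hP)
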